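/- Let $n\ge 0$ be an integer, let $\mathrm{Alt}_n$ be the space of alternating $n\times n$ complex matrices $x=(x_{i,j})$, $x_{j,i}=-x_{i,j}$, $x_{i,i}=0$, and let $\mathbb C[\mathrm{Alt}_n]$ be its algebra of polynomial functions, i.e. the polynomial ring in the $x_{i,j}$, $i<j$. Let $M=(x_{i,j})$ and $D=(\partial_{i,j})$ be the alternating $n\times n$ matrices whose $(i,j)$ entries, for $i<j$, are the operators on $\mathbb C[\mathrm{Alt}_n]$ of multiplication by $x_{i,j}$ and of differentiation $\partial/\partial x_{i,j}$. Let $\mathscr{PD}(\mathrm{Alt}_n)$ be the algebra generated by these operators over $\mathbb C$, and let $\mathscr{PD}(\mathrm{Alt}_n)^{GL_n}$ be the subalgebra of the elements that commute with $\pi(g)$ for all $g\in GL_n(\mathbb C)$, where $(\pi(g)f)(x)=f(g^{-1}x\,{}^t g^{-1})$. For an alternating $2m\times 2m$ matrix $A$ over a (not necessarily commutative) $\mathbb C$-algebra put $$\mathrm{Pf}(A)=\frac1{2^m m!}\sum_{\sigma\in\mathfrak S_{2m}}\mathrm{sgn}(\sigma)\,A_{\sigma(1),\sigma(2)}A_{\sigma(3),\sigma(4)}\cdots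 A_{\sigma(2m-1),\sigma(2m)}$$ (products in this order; $\mathrm{Pf}=1$ for $m=0$). Let $J_r$ be the $r\times r$ matrix with $1$'s on the anti-diagonal and $0$'s elsewhere. For an anti-alternating $2m\times 2m$ matrix $X$ (one for which $XJ_{2m}$ is alternating) put $\mathrm{Pf}(X):=\mathrm{Pf}(XJ_{2m})$. For $u\in\mathbb C$ let $$\Phi(u)=\begin{bmatrix} M & uJ_n\\ -uJ_n & -J_nDJ_n\end{bmatrix}J_{2n},$$ so that the $(a,b)$ entry of the lower right block $-J_nDJ_n$ is $\partial_{n+1-b,\,n+1-a}$. For $0\le k\le\lfloor n/2\rfloor$ let $$\Gamma_k=\sum_{I\subset\{1,\dots,n\},\ |I|=2k}\mathrm{Pf}(x_I)\,\mathrm{Pf}(\partial_I),$$ where $x_I$ and $\partial_I$ are the submatrices of $M$ and $D$ with row and column indices in $I$, in increasing order. For $m\ge0$ let $$a_m(u)=\sum_{k=0}^{\lfloor m/2\rfloor}\frac{m!}{2^{2k}\,(m-2k)!\,k!}\,u^{m-2k},\qquad H_m(x)=(-1)^m e^{x^2}\Big(\frac{d}{dx}\Big)^m e^{-x^2}.$$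 **Theorem.** 1. For every $u\in\mathbb C$, $\displaystyle \mathrm{Pf}(\Phi(u))=\sum_{k=0}^{\lfloor n/2\rfloor}a_{n-2k}(u)\,\Gamma_k$. 2. $\Gamma_k\in\mathscr{PD}(\mathrm{Alt}_n)^{GL_n}$ for $0\le k\le\lfloor n/2\rfloor$. 3. For every $m\ge 0$, $a_m$ is a monic polynomial of degree $m$, and $a_m(u)=\left(-\tfrac{i}{2}\right)^m H_m(iu)$ for all $u\in\mathbb C$, where $i=\sqrt{-1}$. -/

import Mathlib

open scoped Nat

noncomputable section

namespace SkewCapelli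

/-- The coordinates `x_{i,j}`, `i < j`, on the space of alternating `n × n` matrices. -/
abbrev Coord (n : ℕ) : Type := {p : Fin n × Fin n // p.1 < p.2}

/-- The algebra `ℂ[Alt_n]` of polynomial functions on the alternating `n × n` complex matrices,
as the polynomial ring in the coordinates `x_{i,j}`, `i < j`. -/
abbrev PolyAlt (n : ℕ) : Type := MvPolynomial (Coord n) ℂ

/-- The algebra of all `ℂ`-linear operators on `ℂ[Alt_n]`, with composition as product. -/
abbrev Op (n : ℕ) : Type := Module.End ℂ (PolyAlt n)

/-- The alternating matrix whose `(i,j)` entry is `f ⟨(i,j), _⟩` for `i < j`. -/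
def altMatrix {n : ℕ} {R : Type*} [Ring R] (f : Coord n → R) : Matrix (Fin n) (Fin n) R :=
  Matrix.of fun i j =>
    if h : i < j then f ⟨(i, j), h⟩ else if h : j < i then -f ⟨(j, i), h⟩ else 0

/-- Multiplication by the coordinate `x_p`. -/
def mulOp {n : ℕ} (p : Coord n) : Op n := LinearMap.mulLeft ℂ (MvPolynomial.X p : PolyAlt n)

/-- The derivation `∂/∂x_p`. -/
def derivOp {n : ℕ} (p : Coord n) : Op n :=
  (MvPolynomial.pderiv p : Derivation ℂ (PolyAlt n) (PolyAlt n)).toLinearMap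

/-- The alternating matrix `M = (x_{i,j})` of multiplication operators. -/
def matM (n : ℕ) : Matrix (Fin n) (Fin n) (Op n) := altMatrix mulOp

/-- The alternating matrix `D = (∂_{i,j})` of derivations. -/
def matD (n : ℕ) : Matrix (Fin n) (Fin n) (Op n) := altMatrix derivOp

/-- The ring of differential operators on `Alt_n` with polynomial coefficients. -/
def diffOps (n : ℕ) : Subalgebra ℂ (Op n) :=
  Algebra.adjoin ℂ (Set.range mulOp ∪ Set.range derivOp)

/-- The generic alternating matrix, with entries the coordinate functions. -/
def genericAlt (n : ℕ) : Matrix (Fin n) (Fin n) (PolyAlt n) := altMatrix MvPolynomial.X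

/-- The action `(π(g) f)(x) = f(g⁻¹ x (g⁻¹)ᵀ)` of `GL_n` on `ℂ[Alt_n]`: the coordinate `x_{i,j}`
is replaced by the `(i,j)` entry of `g⁻¹ x (g⁻¹)ᵀ`, where `x` is the generic alternating matrix. -/
def glRep {n : ℕ} (g : Matrix.GeneralLinearGroup (Fin n) ℂ) : Op n :=
  let h : Matrix (Fin n) (Fin n) (PolyAlt n) :=
    ((g⁻¹ : Matrix.GeneralLinearGroup (Fin n) ℂ) : Matrix (Fin n) (Fin n) ℂ).map MvPolynomial.C
  (MvPolynomial.aeval fun p : Coord n =>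
    (h * genericAlt n * h.transpose) p.1.1 p.1.2).toLinearMap

/-- The `GL_n`-invariant differential operators on `Alt_n` with polynomial coefficients, that is,
those which commute with `π(g)` for every `g`. -/
def invDiffOps (n : ℕ) : Subalgebra ℂ (Op n) :=
  diffOps n ⊓ Subalgebra.centralizer ℂ (Set.range (glRep (n := n)))

/-- The Pfaffian of an alternating `2m × 2m` matrix over a not necessarily commutative algebra:
`1 / (2^m m!) ∑_σ sgn(σ) A_{σ(1),σ(2)} A_{σ(3),σ(4)} ⋯ A_{σ(2m-1),σ(2m)}`,
each product being taken in this order. -/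
def pf {m : ℕ} {A : Type*} [Ring A] [Algebra ℂ A] (X : Matrix (Fin (2 * m)) (Fin (2 * m)) A) : A :=
  ((2 ^ m * m ! : ℂ))⁻¹ • ∑ σ : Equiv.Perm (Fin (2 * m)),
    (Equiv.Perm.sign σ : ℤ) • (List.ofFn fun i : Fin m =>
      X (σ ⟨2 * i.val, by omega⟩) (σ ⟨2 * i.val + 1, by omega⟩)).prod

/-- The matrix `J` with `1` on the anti-diagonal and `0` elsewhere. -/
def antiId (m : ℕ) (R : Type*) [Ring R] : Matrix (Fin m) (Fin m) R :=
  Matrix.of fun i j => if j = i.rev then 1 else 0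

/-- The Pfaffian of an anti-alternating matrix `X`, i.e. the Pfaffian of the alternating matrix
`X J`. -/
def antiPf {m : ℕ} {A : Type*} [Ring A] [Algebra ℂ A]
    (X : Matrix (Fin (2 * m)) (Fin (2 * m)) A) : A :=
  pf (X * antiId (2 * m) A)

/-- The alternating matrix with blocks `M`, `u J`, `-u J` and `(∂_{n+1-b,n+1-a})_{a,b}`. -/
def tildePhi (n : ℕ) (u : ℂ) : Matrix (Fin (2 * n)) (Fin (2 * n)) (Op n) :=
  Matrix.reindex (finSumFinEquiv.trans (finCongr (two_mul n).symm))
    (finSumFinEquiv.trans (finCongr (two_mul n).symm))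
    (Matrix.fromBlocks (matM n) (u • antiId n (Op n)) (-(u • antiId n (Op n)))
      (Matrix.of fun a b => matD n b.rev a.rev))

/-- The anti-alternating matrix `Φ(u)`. -/
def Phi (n : ℕ) (u : ℂ) : Matrix (Fin (2 * n)) (Fin (2 * n)) (Op n) :=
  tildePhi n u * antiId (2 * n) (Op n)

/-- The submatrix with row and column indices in `I`, listed in increasing order. -/
def subMat {n r : ℕ} {A : Type*} (X : Matrix (Fin n) (Fin n) A) (I : Finset (Fin n))
    (h : I.card = r) : Matrix (Fin r) (Fin r) A :=
  X.submatrix (I.orderEmbOfFin h) (I.orderEmbOfFin h)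

/-- `Γ_k = ∑_{|I| = 2k} Pf(x_I) Pf(∂_I)`. -/
def Gam (n k : ℕ) : Op n :=
  ∑ I : {I : Finset (Fin n) // I.card = 2 * k},
    pf (subMat (matM n) I.1 I.2) * pf (subMat (matD n) I.1 I.2)

/-- `a_m(u) = ∑_{k ≤ m/2} m! / (2^{2k} (m-2k)! k!) u^{m-2k}`. -/
def aPoly (m : ℕ) : Polynomial ℂ :=
  ∑ k ∈ Finset.range (m / 2 + 1),
    Polynomial.C ((m ! : ℂ) / (2 ^ (2 * k) * (m - 2 * k)! * k !)) * Polynomial.X ^ (m - 2 * k)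

/-- The (physicists') Hermite polynomial `H_m(x) = (-1)^m e^{x²} (d/dx)^m e^{-x²}`, as a function
of a complex variable. -/
def hermiteH (m : ℕ) (x : ℂ) : ℂ :=
  (-1) ^ m * Complex.exp (x ^ 2) * iteratedDeriv m (fun z : ℂ => Complex.exp (-z ^ 2)) x

end SkewCapelli

end

/-! The Pfaffian is the top coefficient of a power in `A ⊗ Λ(V)`: if `Q = ∑ X_{ab} ⊗ z_a z_b` then
`Q^n = 2^n n! Pf(X) ⊗ z_1⋯z_{2n}`, with no commutativity of the entries needed (`quad_pow_self`).
For the block matrix, `Q = 2(x + d + uτ)` with `x = ½∑ M_{ab} v_a v_b`, `d = -½∑ D_{ab} w_a w_b`, `τ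
= ∑ v_a w_a` (`quad_blockMat`). The canonical commutation relations give `[d, x] = ½τ²`, and `τ` is
central. Hence `exp T(x+d+uτ) = exp(Tx) exp(Td) exp(uτT + τ²T²/4)`, and the last factor generates
the `a_m(u) τ^m / m!` (`add_add_pow`). In total degree `n`, the product `x^a d^b τ^m` vanishes for
`a ≠ b`, while `x^k d^k τ^{n-2k}` is a constant times `Γ_k ⊗ τ^n`; reading off the top coefficient
gives part 1. The same identity defines `Γ_k` through `x`, `d`, `τ` for any vectors `v`, `w`.
Conjugation by `π(g)` only changes `v` and `w`, in such a way that `τ` is preserved, so `Γ_k` is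
invariant (`semiconjBy_pfSum`, `commute_pfSum`). Part 3 follows from the recursion `a_{m+1} = u a_m
+ ½ a_m'`. -/

open scoped Nat

noncomputable section

namespace SkewCapelli

/-! ### Powers of sums of commuting nilpotent elements. -/

section CommutingPairs

variable {R : Type*} [Ring R]

theorem add_pow_succ_of_sq_zero {t s : R} (h : Commute t s) (ht : t * t = 0) (m : ℕ) :
    (t + s) ^ (m + 1) = s ^ (m + 1) + (m + 1) • (t * s ^ m) := by
  induction m with
  | zero => simp [add_comm]
  | succ m ih =>
    have h1 : t * (t * s ^ m) = 0 := by rw [← mul_assoc, ht, zero_mul]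
    have h2 : s * (t * s ^ m) = t * s ^ (m + 1) := by
      rw [← mul_assoc, ← h.eq, mul_assoc, ← pow_succ']
    rw [pow_succ' _ (m + 1), ih, add_mul, mul_add, mul_add, mul_smul_comm, mul_smul_comm, h1, h2,
      smul_zero, add_zero, ← pow_succ' s (m + 1), succ_nsmul _ (m + 1)]
    abel

/-- A product with more factors than there are summands repeats one of them, whose square is zero.
-/
theorem sum_pow_eq_zero_of_sq_zero {α : Type*} (t : α → R)
    (hc : ∀ i j, Commute (t i) (t j)) (hs : ∀ i, t i * t i = 0) (s : Finset α) (m : ℕ)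
    (hm : s.card < m) : (∑ i ∈ s, t i) ^ m = 0 := by
  classical
  induction s using Finset.induction_on generalizing m with
  | empty => rw [Finset.sum_empty, zero_pow (by simp at hm; omega)]
  | insert a s ha ih =>
    rw [Finset.card_insert_of_notMem ha] at hm
    obtain ⟨m, rfl⟩ : ∃ k, m = k + 1 := ⟨m - 1, by omega⟩
    rw [Finset.sum_insert ha, add_pow_succ_of_sq_zero (Commute.sum_right _ _ _ fun i _ => hc a i)
      (hs a), ih _ (by omega), ih _ (by omega)]
    simp

theorem add_pow_mul_of_mul_eq_zero {a b z : R} (h : Commute a b) (hz : a * z = 0) (m : ℕ) :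
    (a + b) ^ m * z = b ^ m * z := by
  induction m with
  | zero => simp
  | succ m ih =>
    have : a * (b ^ m * z) = 0 := by
      rw [← mul_assoc, (h.pow_right m).eq, mul_assoc, hz, mul_zero]
    rw [pow_succ', mul_assoc, ih, add_mul, this, zero_add, ← mul_assoc, ← pow_succ']

theorem add_pow_of_pow_succ_eq_zero {a b : R} (h : Commute a b) (p q : ℕ)
    (ha : a ^ (p + 1) = 0) (hb : b ^ (q + 1) = 0) :
    (a + b) ^ (p + q) = (p + q).choose p • (a ^ p * b ^ q) := by
  rw [h.add_pow, Finset.sum_eq_single p]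
  · rw [Nat.add_sub_cancel_left, nsmul_eq_mul, (Nat.cast_commute _ _).eq]
  · intro i hi hip
    rcases Nat.lt_or_ge p i with h1 | h1
    · rw [pow_eq_zero_of_le (show p + 1 ≤ i from h1) ha]; simp
    · rw [pow_eq_zero_of_le (show q + 1 ≤ p + q - i by omega) hb]; simp
  · intro hp
    exact absurd (Finset.mem_range.2 (by omega)) hp

end CommutingPairs

/-! ### Exterior algebra: the central element pairing two families of vectors. -/

section Exterior

open ExteriorAlgebra

variable {V : Type*} [AddCommGroup V] [Module ℂ V]

theorem ι_mul_ι_comm (a b : V) : ι ℂ a * ι ℂ b = -(ι ℂ b * ι ℂ a) :=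
  eq_neg_of_add_eq_zero_left (ι_add_mul_swap a b)

theorem commute_ι_mul_ι (a b : V) (z : ExteriorAlgebra ℂ V) : Commute (ι ℂ a * ι ℂ b) z := by
  induction z using ExteriorAlgebra.induction with
  | algebraMap r => exact Algebra.commute_algebraMap_right _ _
  | ι x =>
    change _ * _ = _ * _
    rw [mul_assoc, ι_mul_ι_comm b x, mul_neg, ← mul_assoc, ι_mul_ι_comm a x, neg_mul, neg_neg,
      mul_assoc]
  | mul a b ha hb => exact ha.mul_right hb
  | add a b ha hb => exact ha.add_right hb

theorem ι_mul_ι_mul_self (a b : V) : (ι ℂ a * ι ℂ b) * (ι ℂ a * ι ℂ b) = 0 := by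
  rw [← mul_assoc, (commute_ι_mul_ι a b (ι ℂ a)).eq, ← mul_assoc, ι_sq_zero]
  simp

theorem ι_mul_ιMulti (x : V) {r : ℕ} (v : Fin r → V) :
    ι ℂ x * ιMulti ℂ r v = (-1) ^ r * (ιMulti ℂ r v * ι ℂ x) := by
  induction r with
  | zero => simp
  | succ r ih =>
    rw [ιMulti_succ_apply, ← mul_assoc, ι_mul_ι_comm, neg_mul, mul_assoc, ih, pow_succ',
      ← mul_assoc (ι ℂ (v 0)), ← ((Commute.neg_one_left (ι ℂ (v 0))).pow_left r).eq]
    simp [mul_assoc]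

theorem ι_mul_ιMulti_eq_zero {r : ℕ} (v : Fin r → V) (i : Fin r) :
    ι ℂ (v i) * ιMulti ℂ r v = 0 := by
  have : ι ℂ (v i) * ιMulti ℂ r v = ιMulti ℂ (r + 1) (Fin.cons (v i) v : Fin (r + 1) → V) := by
    rw [ιMulti_succ_apply]; rfl
  rw [this]
  exact AlternatingMap.map_eq_zero_of_eq _ _ (i := 0) (j := i.succ) (by simp)
    (Fin.succ_ne_zero i).symm

theorem ιMulti_succ_last {r : ℕ} (v : Fin (r + 1) → V) :
    ιMulti ℂ (r + 1) v = ιMulti ℂ r (Fin.init v) * ι ℂ (v (Fin.last r)) := by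
  rw [ιMulti_apply, List.ofFn_succ', List.concat_eq_append, List.prod_append, ιMulti_apply]
  simp [Fin.init]

/-- Bringing the last vector to the front passes `r` others; the exponents add up by Pascal's rule.
-/
theorem ιMulti_comp_rev {r : ℕ} (w : Fin r → V) :
    ιMulti ℂ r (w ∘ Fin.rev) = (-1) ^ (r.choose 2) * ιMulti ℂ r w := by
  induction r with
  | zero => simp
  | succ r ih =>
    have h1 : Matrix.vecTail (w ∘ Fin.rev) = Fin.init w ∘ Fin.rev := by
      funext i
      simp [Matrix.vecTail, Fin.init, Fin.rev_succ]
    have h2 : (w ∘ Fin.rev) 0 = w (Fin.last r) := by simp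
    rw [ιMulti_succ_apply, h1, h2, ih, ιMulti_succ_last w, Nat.choose_succ_succ' r 1,
      Nat.choose_one_right, pow_add, ← mul_assoc,
      ← ((Commute.neg_one_left (ι ℂ (w (Fin.last r)))).pow_left _).eq, mul_assoc, ι_mul_ιMulti,
      ← mul_assoc, ← pow_add, ← pow_add, add_comm]

/-- The square-zero element `∑ i ∈ s, v i ∧ w i` pairing two families of vectors. -/
def pairing {α : Type*} (v w : α → V) (s : Finset α) : ExteriorAlgebra ℂ V :=
  ∑ i ∈ s, ι ℂ (v i) * ι ℂ (w i)

theorem commute_pairing {α : Type*} (v w : α → V) (s : Finset α) (z : ExteriorAlgebra ℂ V) :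
    Commute (pairing v w s) z :=
  Commute.sum_left _ _ _ fun _ _ => commute_ι_mul_ι _ _ _

theorem pairing_pow_eq_zero {α : Type*} (v w : α → V) (s : Finset α) (m : ℕ) (hm : s.card < m) :
    pairing v w s ^ m = 0 :=
  sum_pow_eq_zero_of_sq_zero _ (fun _ _ => commute_ι_mul_ι _ _ _)
    (fun _ => ι_mul_ι_mul_self _ _) s m hm

/-- The terms `v_i w_i` are central with square zero, so each product of all of them occurs `r!`
times. Nesting them as `v_0 (v_1 (⋯) w_1) w_0` costs no sign, which is why the `w_i` come out
reversed. -/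
theorem pairing_pow_univ {r : ℕ} (v w : Fin r → V) :
    pairing v w Finset.univ ^ r = r ! • (ιMulti ℂ r v * ιMulti ℂ r (w ∘ Fin.rev)) := by
  induction r with
  | zero => simp
  | succ r ih =>
    have h0 : pairing v w Finset.univ = ι ℂ (v 0) * ι ℂ (w 0) +
        pairing (Matrix.vecTail v) (Matrix.vecTail w) Finset.univ := by
      simp [pairing, Fin.sum_univ_succ, Matrix.vecTail]
    have h1 : Fin.init (w ∘ Fin.rev) = Matrix.vecTail w ∘ Fin.rev := by
      funext i
      simp [Matrix.vecTail, Fin.init, Fin.rev_castSucc]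
    have h2 : (w ∘ Fin.rev) (Fin.last r) = w 0 := by simp
    have h3 := pairing_pow_eq_zero (Matrix.vecTail v) (Matrix.vecTail w) Finset.univ (r + 1)
      (by simp)
    rw [h0, add_pow_succ_of_sq_zero (commute_ι_mul_ι _ _ _) (ι_mul_ι_mul_self _ _), h3, zero_add, ih,
      ιMulti_succ_apply, ιMulti_succ_last (w ∘ Fin.rev), h1, h2, mul_smul_comm, ← mul_smul,
      Nat.factorial_succ, ((commute_ι_mul_ι (v 0) (w 0) _)).eq]
    congr 1
    set A := ιMulti ℂ r (Matrix.vecTail v)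
    set B := ιMulti ℂ r (Matrix.vecTail w ∘ Fin.rev)
    have h4 : ι ℂ (v 0) * A = (-1) ^ r * (A * ι ℂ (v 0)) := ι_mul_ιMulti _ _
    have h5 : ι ℂ (v 0) * B = (-1) ^ r * (B * ι ℂ (v 0)) := ι_mul_ιMulti _ _
    have h6 : ∀ z : ExteriorAlgebra ℂ V, A * ((-1) ^ r * z) = (-1) ^ r * (A * z) := fun z => by
      rw [← mul_assoc, ← ((Commute.neg_one_left A).pow_left _).eq, mul_assoc]
    have h7 : ((-1) ^ r * (-1) ^ r : ExteriorAlgebra ℂ V) = 1 := by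
      rw [← pow_add, Even.neg_one_pow ⟨r, rfl⟩]
    rw [h4]
    have : (-1) ^ r * (A * ι ℂ (v 0)) * (B * ι ℂ (w 0)) =
        (-1) ^ r * (A * ((ι ℂ (v 0) * B) * ι ℂ (w 0))) := by simp only [mul_assoc]
    rw [this, h5, mul_assoc ((-1) ^ r) (B * _), h6, ← mul_assoc ((-1) ^ r), h7]
    simp only [mul_assoc, one_mul]

theorem pairing_image {n r : ℕ} (v w : Fin n → V) (I : Finset (Fin n)) (h : I.card = r) :
    pairing v w I = pairing (v ∘ I.orderEmbOfFin h) (w ∘ I.orderEmbOfFin h) Finset.univ := by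
  unfold pairing
  conv_lhs => rw [← Finset.image_orderEmbOfFin_univ I h]
  rw [Finset.sum_image fun a _ b _ hab => (I.orderEmbOfFin h).injective hab]
  rfl

/-- The wedge product of the `v i`, `i ∈ I`, in increasing order. -/
def wedge {n r : ℕ} (v : Fin n → V) (I : Finset (Fin n)) (h : I.card = r) : ExteriorAlgebra ℂ V :=
  ιMulti ℂ r (v ∘ I.orderEmbOfFin h)

theorem ι_mul_wedge_eq_zero {n r : ℕ} (v : Fin n → V) (I : Finset (Fin n)) (h : I.card = r)
    (i : Fin n) (hi : i ∈ I) : ι ℂ (v i) * wedge v I h = 0 := by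
  obtain ⟨j, rfl⟩ : ∃ j, I.orderEmbOfFin h j = i := by
    have : i ∈ Set.range (I.orderEmbOfFin h) := by rw [Finset.range_orderEmbOfFin]; exact hi
    exact this
  exact ι_mul_ιMulti_eq_zero (v ∘ I.orderEmbOfFin h) j

theorem pairing_mul_wedge_mul_wedge_eq_zero {n r s : ℕ} (v w : Fin n → V) (I J : Finset (Fin n))
    (hI : I.card = r) (hJ : J.card = s) :
    pairing v w (I ∪ J) * (wedge v I hI * wedge w J hJ) = 0 := by
  rw [pairing, Finset.sum_mul]
  refine Finset.sum_eq_zero fun i hi => ?_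
  rcases Finset.mem_union.1 hi with hi | hi
  · rw [← mul_assoc, (commute_ι_mul_ι _ _ _).eq, ← mul_assoc,
      show wedge v I hI * ι ℂ (v i) = 0 from ?_]
    · simp
    · have h1 := ι_mul_ιMulti (v i) (v ∘ I.orderEmbOfFin hI)
      have h2 := ι_mul_wedge_eq_zero v I hI i hi
      rw [wedge, h1] at h2
      have h3 := congrArg (fun z => (-1) ^ r * z) h2
      simp only [← mul_assoc, ← pow_add, mul_zero] at h3
      rw [Even.neg_one_pow ⟨r, rfl⟩, one_mul] at h3
      exact h3
  · rw [mul_assoc, ← mul_assoc (ι ℂ (w i))]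
    rw [wedge, ι_mul_ιMulti (w i)]
    simp only [mul_assoc, ι_mul_wedge_eq_zero w J hJ i hi, mul_zero]

/-- A pair `v_i w_i` with `i ∈ I ∪ J` repeats a vector of one of the two wedges, so only the
complement contributes. -/
theorem pairing_pow_mul_wedge {n r s : ℕ} (v w : Fin n → V) (I J : Finset (Fin n))
    (hI : I.card = r) (hJ : J.card = s) (m : ℕ) :
    pairing v w Finset.univ ^ m * (wedge v I hI * wedge w J hJ) =
      pairing v w (I ∪ J)ᶜ ^ m * (wedge v I hI * wedge w J hJ) := by
  have : pairing v w Finset.univ = pairing v w (I ∪ J) + pairing v w (I ∪ J)ᶜ :=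
    (Finset.sum_add_sum_compl _ _).symm
  rw [this]
  exact add_pow_mul_of_mul_eq_zero (commute_pairing _ _ _ _)
    (pairing_mul_wedge_mul_wedge_eq_zero _ _ _ _ _ _) m

theorem pairing_pow_mul_wedge_of_ne {n a b m : ℕ} (v w : Fin n → V) (I J : Finset (Fin n))
    (hI : I.card = 2 * a) (hJ : J.card = 2 * b) (h : a + b + m = n) (hIJ : I ≠ J) :
    pairing v w Finset.univ ^ m * (wedge v I hI * wedge w J hJ) = 0 := by
  rw [pairing_pow_mul_wedge, pairing_pow_eq_zero, zero_mul]
  rw [Finset.card_compl, Fintype.card_fin]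
  have h1 := Finset.card_le_card (Finset.subset_union_left (s₁ := I) (s₂ := J))
  have h2 := Finset.card_le_card (Finset.subset_union_right (s₁ := I) (s₂ := J))
  have h4 : (I ∪ J).card ≤ n := by simpa using Finset.card_le_univ (I ∪ J)
  -- Otherwise `|I ∪ J| ≤ a + b`, the mean of `|I|` and `|J|`, which forces `I = I ∪ J = J`.
  by_contra hlt
  refine hIJ ((Finset.eq_of_subset_of_card_le Finset.subset_union_left ?_).trans
    (Finset.eq_of_subset_of_card_le Finset.subset_union_right ?_).symm) <;> omega

/-- Split the pairing into its parts over `I` and `Iᶜ`. By nilpotency only the powers `2k` and `m`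
survive in the `n`-th power, and the part over `I` yields `v_I w_I` up to the sign of reversing `2k`
vectors. -/
theorem pairing_pow_mul_wedge_self {n k m : ℕ} (v w : Fin n → V) (I : Finset (Fin n))
    (hI : I.card = 2 * k) (h : 2 * k + m = n) :
    n ! • (pairing v w Finset.univ ^ m * (wedge v I hI * wedge w I hI)) =
      (-1 : ℤ) ^ k • m ! • pairing v w Finset.univ ^ n := by
  have h1 : pairing v w Finset.univ = pairing v w I + pairing v w Iᶜ :=
    (Finset.sum_add_sum_compl _ _).symm
  have h2 : pairing v w I ^ (2 * k) =
      (2 * k)! • (-1 : ℤ) ^ k • (wedge v I hI * wedge w I hI) := by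
    rw [pairing_image v w I hI, pairing_pow_univ, ιMulti_comp_rev, wedge, wedge]
    congr 1
    -- The exponent `k(2k-1)` has the parity of `k`.
    have : ((2 * k).choose 2) = k + 2 * (k * (k - 1)) := by
      rw [Nat.choose_two_right]
      rcases k with _ | k
      · rfl
      · rw [mul_assoc, Nat.mul_div_cancel_left _ (by norm_num)]
        simp only [Nat.add_sub_cancel, show 2 * (k + 1) - 1 = 2 * k + 1 by omega]
        ring
    rw [this, pow_add, pow_mul, neg_one_sq, one_pow, mul_one, ← mul_assoc,
      ← ((Commute.neg_one_left (ιMulti ℂ _ _)).pow_left k).eq, mul_assoc, zsmul_eq_mul]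
    push_cast
    rfl
  have h3 : pairing v w Finset.univ ^ n =
      n.choose (2 * k) • (pairing v w I ^ (2 * k) * pairing v w Iᶜ ^ m) := by
    rw [h1]
    subst h
    refine add_pow_of_pow_succ_eq_zero (commute_pairing _ _ _ _) _ _
      (pairing_pow_eq_zero _ _ _ _ (by omega)) (pairing_pow_eq_zero _ _ _ _ ?_)
    rw [Finset.card_compl, Fintype.card_fin]; omega
  rw [h3, h2, pairing_pow_mul_wedge, Finset.union_self,
    ((commute_pairing v w Iᶜ _).pow_left m).eq]
  have h4 : n ! = m ! * (n.choose (2 * k) * (2 * k)!) := by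
    rw [← Nat.choose_mul_factorial_mul_factorial (show 2 * k ≤ n by omega),
      show n - 2 * k = m by omega]
    ring
  have h5 : ((-1 : ℤ) ^ k) * (-1) ^ k = 1 := by rw [← mul_pow]; simp
  rw [smul_mul_assoc, smul_mul_assoc, h4]
  simp only [← natCast_zsmul, smul_smul]
  congr 1
  push_cast
  linear_combination (-(m ! : ℤ) * (n.choose (2 * k)) * (2 * k)!) * h5

end Exterior

/-! ### Noncommutative Pfaffians as coefficients of powers of a quadratic element. -/

/-- The ordered product `X (c 0) (c 1) * X (c 2) (c 3) * ⋯`. -/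
def pairProd {A α : Type*} [Ring A] {k : ℕ} (X : Matrix α α A) (c : Fin (2 * k) → α) : A :=
  (List.ofFn fun i : Fin k => X (c ⟨2 * i.val, by omega⟩) (c ⟨2 * i.val + 1, by omega⟩)).prod

theorem pairProd_cons_cons {A α : Type*} [Ring A] {k : ℕ} (X : Matrix α α A) (a b : α)
    (c : Fin (2 * k) → α) :
    pairProd (k := k + 1) X (Fin.cons a (Fin.cons b c : Fin (2 * k + 1) → α) :
      Fin (2 * k + 1 + 1) → α) = X a b * pairProd X c := by
  rw [pairProd, List.ofFn_succ, List.prod_cons]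
  rfl

section Quadratic

open ExteriorAlgebra
open scoped TensorProduct

variable {V : Type*} [AddCommGroup V] [Module ℂ V] {A : Type*} [Ring A] [Algebra ℂ A]

/-- The quadratic element `∑ X a b ⊗ v a ∧ v b`. -/
def quad {α : Type*} [Fintype α] (X : Matrix α α A) (v : α → V) : A ⊗[ℂ] ExteriorAlgebra ℂ V :=
  ∑ a, ∑ b, X a b ⊗ₜ[ℂ] (ι ℂ (v a) * ι ℂ (v b))

theorem sum_fin_add_two {α M : Type*} [Fintype α] [AddCommMonoid M] {r : ℕ}
    (f : (Fin (r + 1 + 1) → α) → M) :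
    ∑ c, f c = ∑ a, ∑ b, ∑ c : Fin r → α, f (Fin.cons a (Fin.cons b c : Fin (r + 1) → α)) := by
  rw [← (Fin.consEquiv fun _ : Fin (r + 1 + 1) => α).sum_comp, Fintype.sum_prod_type]
  refine Finset.sum_congr rfl fun a _ => ?_
  rw [← (Fin.consEquiv fun _ : Fin (r + 1) => α).sum_comp, Fintype.sum_prod_type]
  rfl

theorem quad_pow {α : Type*} [Fintype α] (X : Matrix α α A) (v : α → V) (k : ℕ) :
    quad X v ^ k = ∑ c : Fin (2 * k) → α, pairProd X c ⊗ₜ[ℂ] ιMulti ℂ (2 * k) (v ∘ c) := by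
  induction k with
  | zero =>
    have : Unique (Fin (2 * 0) → α) := inferInstanceAs (Unique (Fin 0 → α))
    rw [Fintype.sum_unique]
    simp [pairProd, Algebra.TensorProduct.one_def]
  | succ k ih =>
    refine Eq.trans ?_ (sum_fin_add_two (r := 2 * k) _).symm
    rw [pow_succ', ih, quad, Finset.sum_mul]
    refine Finset.sum_congr rfl fun a _ => ?_
    rw [Finset.sum_mul]
    refine Finset.sum_congr rfl fun b _ => ?_
    rw [Finset.mul_sum]
    refine Finset.sum_congr rfl fun c _ => ?_
    rw [pairProd_cons_cons, Algebra.TensorProduct.tmul_mul_tmul]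
    congr 1
    change _ = ιMulti ℂ (2 * k + 1 + 1) _
    rw [ιMulti_succ_apply, ιMulti_succ_apply, ← mul_assoc]
    rfl

/-- An injective word is the increasing enumeration of its image preceded by a unique permutation.
-/
theorem injective_sum_eq {N r : ℕ} {M : Type*} [AddCommMonoid M] (f : (Fin r → Fin N) → M)
    (hf : ∀ c, ¬ Function.Injective c → f c = 0) :
    ∑ c, f c = ∑ I : {I : Finset (Fin N) // I.card = r}, ∑ σ : Equiv.Perm (Fin r),
      f (I.1.orderEmbOfFin I.2 ∘ σ) := by
  classical
  rw [← Fintype.sum_prod_type'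
    (f := fun (I : {I : Finset (Fin N) // I.card = r}) (σ : Equiv.Perm (Fin r)) =>
      f (I.1.orderEmbOfFin I.2 ∘ σ))]
  symm
  rw [← Finset.sum_filter_of_ne (p := Function.Injective)
    (fun c _ hc => by by_contra h; exact hc (hf c h))]
  have himg : ∀ x : {I : Finset (Fin N) // I.card = r} × Equiv.Perm (Fin r),
      Finset.univ.image (x.1.1.orderEmbOfFin x.1.2 ∘ x.2) = x.1.1 := fun x => by
    rw [← Finset.image_image, Finset.image_univ_equiv, Finset.image_orderEmbOfFin_univ]
  refine Finset.sum_nbij (fun x => x.1.1.orderEmbOfFin x.1.2 ∘ x.2) ?_ ?_ ?_ fun _ _ => rfl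
  · intro x _
    simpa using (x.1.1.orderEmbOfFin x.1.2).injective.comp x.2.injective
  · rintro x _ y _ h
    have h1 : x.1 = y.1 := Subtype.ext (by rw [← himg x, ← himg y]; exact congrArg (fun c => Finset.univ.image c) h)
    obtain ⟨x1, x2⟩ := x
    obtain ⟨y1, y2⟩ := y
    obtain rfl : x1 = y1 := h1
    refine Prod.ext rfl (Equiv.ext fun i => ?_)
    exact (x1.1.orderEmbOfFin x1.2).injective (congrFun h i)
  · intro c hc
    have hc : Function.Injective c := by simpa using hc
    have hcard : (Finset.univ.image c).card = r := by
      rw [Finset.card_image_of_injective _ hc]; simp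
    let g : Fin r → Fin r := fun i =>
      ((Finset.univ.image c).orderIsoOfFin hcard).symm ⟨c i, by simp⟩
    have hg : ∀ i, (Finset.univ.image c).orderEmbOfFin hcard (g i) = c i := fun i => by
      rw [← Finset.coe_orderIsoOfFin_apply, OrderIso.apply_symm_apply]
    have hgi : Function.Injective g := fun i j hij => hc (by rw [← hg i, ← hg j, hij])
    exact ⟨(⟨_, hcard⟩, Equiv.ofBijective g (Finite.injective_iff_bijective.1 hgi)),
      by simp, funext hg⟩

theorem pf_eq {m : ℕ} (X : Matrix (Fin (2 * m)) (Fin (2 * m)) A) :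
    ((2 ^ m * m ! : ℕ) : ℂ) • pf X =
      ∑ σ : Equiv.Perm (Fin (2 * m)), (Equiv.Perm.sign σ : ℤ) • pairProd X σ := by
  rw [pf, smul_smul]
  push_cast
  rw [mul_inv_cancel₀ (mul_ne_zero (by simp) (by exact_mod_cast Nat.factorial_ne_zero m)), one_smul]
  rfl

/-- Words with a repeated index die in the exterior algebra. Permuting the letters of the others
moves only the wedge factor, so the entries keep the order required by `pf`. -/
theorem quad_pow_eq_sum_pf {N : ℕ} (X : Matrix (Fin N) (Fin N) A) (v : Fin N → V) (k : ℕ) :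
    quad X v ^ k = ((2 ^ k * k ! : ℕ) : ℂ) • ∑ I : {I : Finset (Fin N) // I.card = 2 * k},
      pf (subMat X I.1 I.2) ⊗ₜ[ℂ] wedge v I.1 I.2 := by
  rw [quad_pow, injective_sum_eq, Finset.smul_sum]
  · refine Finset.sum_congr rfl fun I _ => ?_
    rw [TensorProduct.smul_tmul', pf_eq, TensorProduct.sum_tmul]
    refine Finset.sum_congr rfl fun σ _ => ?_
    rw [← Function.comp_assoc, AlternatingMap.map_perm, wedge, TensorProduct.smul_tmul]
    rfl
  · intro c hc
    rw [ιMulti_eq_zero_of_not_inj (fun h => hc h.of_comp), TensorProduct.tmul_zero]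

theorem commute_one_tmul {z : ExteriorAlgebra ℂ V} (hz : ∀ y, Commute z y)
    (x : A ⊗[ℂ] ExteriorAlgebra ℂ V) : Commute ((1 : A) ⊗ₜ[ℂ] z) x := by
  induction x using TensorProduct.induction_on with
  | zero => exact Commute.zero_right _
  | tmul a y =>
    change _ * _ = _ * _
    rw [Algebra.TensorProduct.tmul_mul_tmul, Algebra.TensorProduct.tmul_mul_tmul, (hz y).eq,
      one_mul, mul_one]
  | add x y hx hy => exact hx.add_right hy

/-- Each of the two contractions in the commutator contributes `-τ²`, by antisymmetry of the wedge.
-/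
theorem quad_mul_quad {n : ℕ} (X Y : Matrix (Fin n) (Fin n) A) (v w : Fin n → V)
    (h : ∀ a b i j, Y a b * X i j = X i j * Y a b +
      ((if a = i then 1 else 0) * (if b = j then 1 else 0) -
        (if a = j then 1 else 0) * (if b = i then 1 else 0))) :
    quad Y w * quad X v = quad X v * quad Y w -
      (2 : ℕ) • ((1 : A) ⊗ₜ[ℂ] pairing v w Finset.univ) ^ 2 := by
  have key : ∀ a b i j, (Y a b ⊗ₜ[ℂ] (ι ℂ (w a) * ι ℂ (w b))) * (X i j ⊗ₜ[ℂ] (ι ℂ (v i) * ι ℂ (v j)))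
      = (X i j ⊗ₜ[ℂ] (ι ℂ (v i) * ι ℂ (v j))) * (Y a b ⊗ₜ[ℂ] (ι ℂ (w a) * ι ℂ (w b))) +
      ((if a = i then if b = j then
          (1 : A) ⊗ₜ[ℂ] ((ι ℂ (w a) * ι ℂ (w b)) * (ι ℂ (v i) * ι ℂ (v j))) else 0 else 0) -
        (if a = j then if b = i then
          (1 : A) ⊗ₜ[ℂ] ((ι ℂ (w a) * ι ℂ (w b)) * (ι ℂ (v i) * ι ℂ (v j))) else 0 else 0)) := by
    intro a b i j
    simp only [Algebra.TensorProduct.tmul_mul_tmul]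
    rw [h, TensorProduct.add_tmul, ((commute_ι_mul_ι (v i) (v j) _)).eq]
    congr 1
    rw [TensorProduct.sub_tmul]
    split_ifs <;> simp
  have e1 : quad Y w * quad X v = ∑ a, ∑ b, ∑ i, ∑ j,
      (Y a b ⊗ₜ[ℂ] (ι ℂ (w a) * ι ℂ (w b))) * (X i j ⊗ₜ[ℂ] (ι ℂ (v i) * ι ℂ (v j))) := by
    simp only [quad, Finset.sum_mul]
    simp only [Finset.mul_sum]
  have e2 : quad X v * quad Y w = ∑ a, ∑ b, ∑ i, ∑ j,
      (X i j ⊗ₜ[ℂ] (ι ℂ (v i) * ι ℂ (v j))) * (Y a b ⊗ₜ[ℂ] (ι ℂ (w a) * ι ℂ (w b))) := by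
    simp only [quad, Finset.mul_sum]
    simp only [Finset.sum_mul]
  have e3 : ((1 : A) ⊗ₜ[ℂ] pairing v w Finset.univ) ^ 2 = ∑ a, ∑ b,
      (1 : A) ⊗ₜ[ℂ] ((ι ℂ (w a) * ι ℂ (w b)) * (ι ℂ (v b) * ι ℂ (v a))) := by
    rw [Algebra.TensorProduct.tmul_pow, one_pow, pow_two]
    simp only [pairing, Finset.sum_mul]
    simp only [Finset.mul_sum, TensorProduct.tmul_sum]
    refine Finset.sum_congr rfl fun a _ => Finset.sum_congr rfl fun b _ => ?_
    have : ι ℂ (w a) * ι ℂ (w b) * (ι ℂ (v b) * ι ℂ (v a)) =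
        ι ℂ (w a) * (ι ℂ (w b) * ι ℂ (v b) * ι ℂ (v a)) := by simp only [mul_assoc]
    rw [this, (commute_ι_mul_ι (w b) (v b) _).eq, ← mul_assoc (ι ℂ (w a)), ι_mul_ι_comm (w a),
      ι_mul_ι_comm (w b), neg_mul_neg]
  have e4 : ∀ a b, (1 : A) ⊗ₜ[ℂ] ((ι ℂ (w a) * ι ℂ (w b)) * (ι ℂ (v a) * ι ℂ (v b))) =
      -((1 : A) ⊗ₜ[ℂ] ((ι ℂ (w a) * ι ℂ (w b)) * (ι ℂ (v b) * ι ℂ (v a)))) := fun a b => by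
    rw [ι_mul_ι_comm (v a), mul_neg, TensorProduct.tmul_neg]
  rw [e1, e2, e3]
  simp only [key, Finset.sum_add_distrib, Finset.sum_sub_distrib, Finset.sum_ite_eq,
    Finset.mem_univ, if_true]
  have e6 : ∀ a b, (∑ i, ∑ j, if a = i then if b = j then
      (1 : A) ⊗ₜ[ℂ] ((ι ℂ (w a) * ι ℂ (w b)) * (ι ℂ (v i) * ι ℂ (v j))) else 0 else 0) =
      -((1 : A) ⊗ₜ[ℂ] ((ι ℂ (w a) * ι ℂ (w b)) * (ι ℂ (v b) * ι ℂ (v a)))) := fun a b => by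
    simp only [Finset.sum_ite_irrel, Finset.sum_const_zero, Finset.sum_ite_eq, Finset.mem_univ,
      if_true, e4]
  simp only [e6, Finset.sum_neg_distrib]
  abel

theorem quad_pow_mul_quad_pow_mul_pairing {n a b m : ℕ} (X Y : Matrix (Fin n) (Fin n) A)
    (v w : Fin n → V) (h : a + b + m = n) (hab : a ≠ b) :
    quad X v ^ a * quad Y w ^ b * ((1 : A) ⊗ₜ[ℂ] pairing v w Finset.univ) ^ m = 0 := by
  rw [quad_pow_eq_sum_pf, quad_pow_eq_sum_pf,
    ← ((commute_one_tmul (commute_pairing v w _) _).pow_left m).eq, smul_mul_smul_comm,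
    Algebra.TensorProduct.tmul_pow, one_pow, mul_smul_comm, Finset.sum_mul_sum, Finset.mul_sum]
  rw [Finset.sum_eq_zero, smul_zero]
  intro I _
  rw [Finset.mul_sum]
  refine Finset.sum_eq_zero fun J _ => ?_
  rw [Algebra.TensorProduct.tmul_mul_tmul, Algebra.TensorProduct.tmul_mul_tmul,
    pairing_pow_mul_wedge_of_ne v w _ _ I.2 J.2 h, TensorProduct.tmul_zero]
  intro hIJ
  have := I.2
  rw [hIJ, J.2] at this
  omega

theorem quad_pow_mul_quad_pow_mul_pairing_self {n k m : ℕ} (X Y : Matrix (Fin n) (Fin n) A)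
    (v w : Fin n → V) (h : 2 * k + m = n) :
    (n ! : ℂ) • (((2 : ℂ)⁻¹ • quad X v) ^ k * ((-(2 : ℂ)⁻¹) • quad Y w) ^ k *
      ((1 : A) ⊗ₜ[ℂ] pairing v w Finset.univ) ^ m) =
    ((k ! : ℂ) ^ 2 * m !) • ((∑ I : {I : Finset (Fin n) // I.card = 2 * k},
      pf (subMat X I.1 I.2) * pf (subMat Y I.1 I.2)) ⊗ₜ[ℂ] (pairing v w Finset.univ ^ n)) := by
  have e : quad X v ^ k * quad Y w ^ k * ((1 : A) ⊗ₜ[ℂ] pairing v w Finset.univ) ^ m =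
      ((2 ^ k * k ! : ℕ) * (2 ^ k * k ! : ℕ) : ℂ) •
        ∑ I : {I : Finset (Fin n) // I.card = 2 * k},
        (pf (subMat X I.1 I.2) * pf (subMat Y I.1 I.2)) ⊗ₜ[ℂ]
          (pairing v w Finset.univ ^ m * (wedge v I.1 I.2 * wedge w I.1 I.2)) := by
    rw [quad_pow_eq_sum_pf, quad_pow_eq_sum_pf,
      ← ((commute_one_tmul (commute_pairing v w _) _).pow_left m).eq, smul_mul_smul_comm,
      Algebra.TensorProduct.tmul_pow, one_pow, mul_smul_comm, Finset.sum_mul_sum, Finset.mul_sum]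
    congr 1
    refine Finset.sum_congr rfl fun I _ => ?_
    rw [Finset.mul_sum, Finset.sum_eq_single I]
    · rw [Algebra.TensorProduct.tmul_mul_tmul, Algebra.TensorProduct.tmul_mul_tmul, one_mul]
    · intro J _ hJ
      rw [Algebra.TensorProduct.tmul_mul_tmul, Algebra.TensorProduct.tmul_mul_tmul,
        pairing_pow_mul_wedge_of_ne v w _ _ I.2 J.2 (by omega), TensorProduct.tmul_zero]
      exact fun h => hJ (Subtype.ext h.symm)
    · simp
  rw [smul_pow, smul_pow, smul_mul_smul_comm, smul_mul_assoc, e, TensorProduct.sum_tmul]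
  simp only [Finset.smul_sum]
  refine Finset.sum_congr rfl fun I _ => ?_
  have e2 : (n ! : ℂ) • (pairing v w Finset.univ ^ m * (wedge v I.1 I.2 * wedge w I.1 I.2)) =
      ((-1 : ℂ) ^ k * m !) • pairing v w Finset.univ ^ n := by
    have := pairing_pow_mul_wedge_self v w I.1 I.2 h
    rw [← Nat.cast_smul_eq_nsmul ℂ, ← Int.cast_smul_eq_zsmul ℂ, ← Nat.cast_smul_eq_nsmul ℂ,
      smul_smul] at this
    push_cast at this
    exact this
  rw [smul_smul, smul_smul, mul_assoc]
  -- The factors `2^k k!` of the two Pfaffians absorb the halves. The remaining `(-1)^k`, due to the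
  -- minus sign in front of `quad Y w`, cancels the reversal sign in `e2`.
  rw [show (n ! : ℂ) * ((2⁻¹ ^ k * (-2⁻¹) ^ k) * (((2 ^ k * k ! : ℕ) : ℂ) * ((2 ^ k * k ! : ℕ) : ℂ)))
    = ((-1) ^ k * (k ! : ℂ) ^ 2) * (n ! : ℂ) from ?_]
  · rw [mul_smul, ← TensorProduct.tmul_smul, e2, TensorProduct.tmul_smul, smul_smul]
    congr 1
    have : ((-1 : ℂ) ^ k) * (-1) ^ k = 1 := by rw [← mul_pow]; simp
    linear_combination ((k ! : ℂ) ^ 2 * m !) * this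
  · push_cast
    have h1 : (2⁻¹ : ℂ) ^ k * 2 ^ k = 1 := by rw [← mul_pow]; norm_num
    have h2 : (-2⁻¹ : ℂ) ^ k * 2 ^ k = (-1) ^ k := by rw [← mul_pow]; norm_num
    linear_combination (n ! * (k ! : ℂ) ^ 2 * (-2⁻¹ : ℂ) ^ k * 2 ^ k) * h1 +
      (n ! * (k ! : ℂ) ^ 2) * h2

end Quadratic

/-! ### The polynomials `a_m` and their relation to Hermite polynomials. -/

section Hermite

open Polynomial

theorem aPoly_coeff_add_two_mul (j k : ℕ) :
    (aPoly (j + 2 * k)).coeff j = ((j + 2 * k)! : ℂ) / (2 ^ (2 * k) * j ! * k !) := by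
  rw [aPoly, finsetSum_coeff, Finset.sum_eq_single k]
  · rw [coeff_C_mul_X_pow, if_pos (by omega), Nat.add_sub_cancel]
  · intro l hl hlk
    rw [Finset.mem_range] at hl
    rw [coeff_C_mul_X_pow, if_neg (by omega)]
  · intro hk
    exact absurd (Finset.mem_range.2 (by omega)) hk

theorem aPoly_coeff_eq_zero (m j : ℕ) (h : ∀ k, m ≠ j + 2 * k) : (aPoly m).coeff j = 0 := by
  rw [aPoly, finsetSum_coeff]
  refine Finset.sum_eq_zero fun k hk => ?_
  rw [Finset.mem_range] at hk
  rw [coeff_C_mul_X_pow, if_neg]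
  intro hj
  exact h k (by omega)

theorem aPoly_zero : aPoly 0 = 1 := by simp [aPoly]

/-- Together with `derivative_aPoly_succ` this encodes the generating function `exp(uT + T²/4)`. -/
theorem aPoly_succ (m : ℕ) :
    aPoly (m + 1) = X * aPoly m + C (2⁻¹ : ℂ) * derivative (aPoly m) := by
  ext j
  rw [coeff_add, coeff_C_mul, coeff_derivative]
  by_cases h : ∃ k, m + 1 = j + 2 * k
  · obtain ⟨k, hk⟩ := h
    rw [hk, aPoly_coeff_add_two_mul]
    rcases j with _ | j
    · obtain ⟨k, rfl⟩ : ∃ l, k = l + 1 := ⟨k - 1, by omega⟩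
      obtain rfl : m = 0 + 1 + 2 * k := by omega
      rw [aPoly_coeff_add_two_mul, mul_coeff_zero, coeff_X_zero, zero_mul, zero_add, zero_add,
        show 2 * (k + 1) = (0 + 1 + 2 * k) + 1 by ring, Nat.factorial_succ (0 + 1 + 2 * k),
        Nat.factorial_succ k]
      have := Nat.factorial_ne_zero k
      push_cast
      field_simp
      ring
    · obtain rfl : m = j + 2 * k := by omega
      rw [coeff_X_mul, aPoly_coeff_add_two_mul]
      have h1 := Nat.factorial_ne_zero k
      have h2 := Nat.factorial_ne_zero j
      rw [show j + 1 + 2 * k = (j + 2 * k) + 1 by ring, Nat.factorial_succ (j + 2 * k),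
        Nat.factorial_succ j]
      rcases k with _ | k
      · rw [aPoly_coeff_eq_zero _ (j + 1 + 1) (by intro k; omega)]
        push_cast
        field_simp
        ring
      · have h3 := Nat.factorial_ne_zero k
        have e : aPoly (j + 2 * (k + 1)) = aPoly (j + 1 + 1 + 2 * k) := by congr 1; ring
        rw [e, aPoly_coeff_add_two_mul, show j + 1 + 1 + 2 * k = j + 2 * (k + 1) by ring,
          Nat.factorial_succ k, Nat.factorial_succ (j + 1), Nat.factorial_succ j]
        have h4 : (j : ℂ) + 1 + 1 ≠ 0 := by exact_mod_cast Nat.succ_ne_zero (j + 1)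
        push_cast
        field_simp
        ring
  · push Not at h
    rw [aPoly_coeff_eq_zero _ _ h, aPoly_coeff_eq_zero m (j + 1)
      fun k hk => h (k + 1) (by omega)]
    rcases j with _ | j
    · simp
    · rw [coeff_X_mul, aPoly_coeff_eq_zero m j fun k hk => h k (by omega)]
      simp

theorem derivative_aPoly_succ (m : ℕ) :
    derivative (aPoly (m + 1)) = C ((m : ℂ) + 1) * aPoly m := by
  ext j
  rw [coeff_C_mul, coeff_derivative]
  by_cases h : ∃ k, m = j + 2 * k
  · obtain ⟨k, rfl⟩ := h
    rw [aPoly_coeff_add_two_mul, show j + 2 * k + 1 = j + 1 + 2 * k by ring,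
      aPoly_coeff_add_two_mul, show j + 1 + 2 * k = (j + 2 * k) + 1 by ring,
      Nat.factorial_succ (j + 2 * k), Nat.factorial_succ j]
    have h1 := Nat.factorial_ne_zero k
    have h2 := Nat.factorial_ne_zero j
    push_cast
    field_simp
  · push Not at h
    rw [aPoly_coeff_eq_zero _ _ h, aPoly_coeff_eq_zero _ (j + 1) fun k hk => h k (by omega)]
    simp

theorem aPoly_monic_natDegree (m : ℕ) : (aPoly m).Monic ∧ (aPoly m).natDegree = m := by
  have h1 : (aPoly m).natDegree ≤ m := by
    rw [natDegree_le_iff_coeff_eq_zero]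
    exact fun j hj => aPoly_coeff_eq_zero _ _ fun k => by omega
  have h2 : (aPoly m).coeff m = 1 := by
    have := aPoly_coeff_add_two_mul m 0
    have h3 := Nat.factorial_ne_zero m
    simpa [h3] using this
  exact ⟨monic_of_natDegree_le_of_coeff_eq_one m h1 h2,
    natDegree_eq_of_le_of_coeff_ne_zero h1 (by simp [h2])⟩

/-- Differentiating `p(-iz) e^{-z²}` gives `-2i (½p' + Xp)(-iz) e^{-z²}`, which is the recursion
`aPoly_succ`. -/
theorem iteratedDeriv_gaussian (m : ℕ) :
    iteratedDeriv m (fun z : ℂ => Complex.exp (-z ^ 2)) = fun z =>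
      (-2 * Complex.I) ^ m * (aPoly m).eval (-Complex.I * z) * Complex.exp (-z ^ 2) := by
  induction m with
  | zero => simp [aPoly_zero]
  | succ m ih =>
    rw [iteratedDeriv_succ, ih]
    funext z
    have h1 : HasDerivAt (fun z : ℂ => -Complex.I * z) (-Complex.I) z := by
      simpa using (hasDerivAt_id z).const_mul (-Complex.I)
    have h2 : HasDerivAt (fun z : ℂ => (aPoly m).eval (-Complex.I * z))
        ((derivative (aPoly m)).eval (-Complex.I * z) * -Complex.I) z :=
      HasDerivAt.comp z ((aPoly m).hasDerivAt _) h1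
    have h3 : HasDerivAt (fun z : ℂ => Complex.exp (-z ^ 2))
        (Complex.exp (-z ^ 2) * -(2 * z)) z := by
      have := ((hasDerivAt_pow 2 z).neg).cexp
      simpa using this
    have h4 := (h2.const_mul ((-2 * Complex.I) ^ m)).mul h3
    refine (HasDerivAt.deriv h4).trans ?_
    rw [ aPoly_succ]
    simp only [eval_add, eval_mul, eval_X, eval_C, pow_succ (-2 * Complex.I) m]
    linear_combination (-2 * (-2 * Complex.I) ^ m * z * Complex.exp (-z ^ 2) *
      (aPoly m).eval (-Complex.I * z)) * Complex.I_mul_I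

theorem aPoly_eval_eq_hermiteH (m : ℕ) (u : ℂ) :
    (aPoly m).eval u = (-Complex.I / 2) ^ m * hermiteH m (Complex.I * u) := by
  rw [hermiteH, iteratedDeriv_gaussian]
  have h1 : -Complex.I * (Complex.I * u) = u := by linear_combination (-u) * Complex.I_mul_I
  have h2 : Complex.exp ((Complex.I * u) ^ 2) * Complex.exp (-(Complex.I * u) ^ 2) = 1 := by
    rw [← Complex.exp_add]; simp
  have h3 : (-Complex.I / 2) ^ m * (-1) ^ m * (-2 * Complex.I) ^ m = 1 := by
    rw [← mul_pow, ← mul_pow, show -Complex.I / 2 * -1 * (-2 * Complex.I) = 1 from ?_, one_pow]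
    linear_combination (-1) * Complex.I_mul_I
  simp only [h1]
  linear_combination (-(aPoly m).eval u) * h3 - (aPoly m).eval u *
    ((-Complex.I / 2) ^ m * (-1) ^ m * (-2 * Complex.I) ^ m) * h2

end Hermite

/-! ### Disentangling `(x + d + ut)^N` when `[d, x] = ½t²` with `t` commuting with `x` and `d`. -/

section Heisenberg

variable {R : Type*} [Ring R] [Algebra ℂ R]

/-- The Cauchy product of two sequences. -/
def conv (f g : ℕ → R) (N : ℕ) : R := ∑ p ∈ Finset.HasAntidiagonal.antidiagonal N, f p.1 * g p.2

/-- The sequence `0, f 0, f 1, …`. -/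
def shift (f : ℕ → R) : ℕ → R
  | 0 => 0
  | N + 1 => f N

omit [Algebra ℂ R] in
theorem conv_shift_left (f g : ℕ → R) (N : ℕ) : conv (shift f) g N = shift (conv f g) N := by
  rcases N with _ | N
  · simp [conv, shift]
  · rw [conv, Finset.Nat.sum_antidiagonal_succ]
    simp [shift, conv]

omit [Algebra ℂ R] in
theorem conv_shift_right (f g : ℕ → R) (N : ℕ) : conv f (shift g) N = shift (conv f g) N := by
  rcases N with _ | N
  · simp [conv, shift]
  · rw [conv, Finset.Nat.sum_antidiagonal_succ']
    simp [shift, conv]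

-- Sequences are read as coefficients of power series in `T`: `conv` is the product, `shift` is
-- multiplication by `T`, and `(N + 1) • f (N + 1)` is the derivative. This is then the Leibniz
-- rule.
omit [Algebra ℂ R] in
theorem conv_succ (f g : ℕ → R) (N : ℕ) :
    (N + 1) • conv f g (N + 1) =
      ∑ p ∈ Finset.HasAntidiagonal.antidiagonal N, ((p.1 + 1) • f (p.1 + 1) * g p.2) +
      ∑ p ∈ Finset.HasAntidiagonal.antidiagonal N, f p.1 * ((p.2 + 1) • g (p.2 + 1)) := by
  have h : (N + 1) • conv f g (N + 1) =
      ∑ p ∈ Finset.HasAntidiagonal.antidiagonal (N + 1), (p.1 • f p.1 * g p.2) +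
      ∑ p ∈ Finset.HasAntidiagonal.antidiagonal (N + 1), f p.1 * (p.2 • g p.2) := by
    rw [conv, Finset.smul_sum, ← Finset.sum_add_distrib]
    refine Finset.sum_congr rfl fun p hp => ?_
    rw [← Finset.HasAntidiagonal.mem_antidiagonal.1 hp, add_smul, smul_mul_assoc, mul_smul_comm]
  rw [h, Finset.Nat.sum_antidiagonal_succ, Finset.Nat.sum_antidiagonal_succ']
  simp

/-- The divided power `x ^ m / m!`. -/
def divPow (x : R) (m : ℕ) : R := (m ! : ℂ)⁻¹ • x ^ m

theorem succ_smul_divPow_succ (x : R) (m : ℕ) : (m + 1) • divPow x (m + 1) = x * divPow x m := by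
  rw [divPow, divPow, mul_smul_comm, ← pow_succ', ← Nat.cast_smul_eq_nsmul ℂ, smul_smul,
    Nat.factorial_succ]
  congr 1
  have h1 : (m ! : ℂ) ≠ 0 := by exact_mod_cast Nat.factorial_ne_zero m
  have h2 : (m : ℂ) + 1 ≠ 0 := by exact_mod_cast Nat.succ_ne_zero m
  push_cast
  field_simp

/-- Coefficientwise form of `d e^{Tx} = e^{Tx} d + cT e^{Tx}`. -/
theorem mul_divPow {x d c : R} (hd : d * x = x * d + c) (hc : Commute c x) (m : ℕ) :
    d * divPow x m = divPow x m * d + c * shift (divPow x) m := by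
  rcases m with _ | m
  · simp [divPow, shift]
  have h : ∀ m : ℕ, d * x ^ (m + 1) = x ^ (m + 1) * d + (m + 1) • (c * x ^ m) := fun m => by
    induction m with
    | zero => simp [hd]
    | succ m ih =>
      rw [pow_succ, ← mul_assoc, ih, add_mul, mul_assoc (x ^ (m + 1)), hd, mul_add, ← mul_assoc,
        smul_mul_assoc, mul_assoc c, ← pow_succ x m, ← (hc.pow_right (m + 1)).eq,
        succ_nsmul _ (m + 1)]
      abel
  rw [shift, divPow, mul_smul_comm, h, smul_add, smul_mul_assoc]
  congr 1
  rw [divPow, mul_smul_comm, ← Nat.cast_smul_eq_nsmul ℂ, smul_smul, Nat.factorial_succ]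
  congr 1
  have h1 : (m ! : ℂ) ≠ 0 := by exact_mod_cast Nat.factorial_ne_zero m
  have h2 : (m : ℂ) + 1 ≠ 0 := by exact_mod_cast Nat.succ_ne_zero m
  push_cast
  field_simp

/-- With `K = e^{Tx} e^{Td}` this says `(x + d) K = K' + cT K`. -/
theorem add_mul_conv_divPow {x d c : R} (hd : d * x = x * d + c) (hc : Commute c x) (N : ℕ) :
    (x + d) * conv (divPow x) (divPow d) N =
      (N + 1) • conv (divPow x) (divPow d) (N + 1) +
        c * shift (conv (divPow x) (divPow d)) N := by
  rw [conv_succ, ← conv_shift_left, add_mul, add_assoc]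
  simp only [conv, Finset.mul_sum]
  simp only [← Finset.sum_add_distrib]
  refine Finset.sum_congr rfl fun p _ => ?_
  rw [succ_smul_divPow_succ, succ_smul_divPow_succ, ← mul_assoc d, mul_divPow hd hc, add_mul,
    mul_assoc, mul_assoc, mul_assoc]

/-- The sequence `a_m(u) T ^ m / m!`. -/
def hermiteTerm (u : ℂ) (t : R) (m : ℕ) : R := (aPoly m).eval u • divPow t m

/-- The differential equation `h' = (ut + ½t²T) h` of `h = exp(utT + t²T²/4)`. -/
theorem succ_smul_hermiteTerm_succ (u : ℂ) (t : R) (m : ℕ) :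
    (m + 1) • hermiteTerm u t (m + 1) =
      u • t * hermiteTerm u t m + (2⁻¹ : ℂ) • t ^ 2 * shift (hermiteTerm u t) m := by
  rw [hermiteTerm, smul_comm, succ_smul_divPow_succ]
  rcases m with _ | m
  · simp [aPoly_succ, aPoly_zero, hermiteTerm, shift, divPow]
  · rw [shift, hermiteTerm, hermiteTerm, aPoly_succ (m + 1), derivative_aPoly_succ]
    rw [smul_mul_smul_comm, smul_mul_smul_comm, pow_two, mul_assoc, ← succ_smul_divPow_succ t m,
      mul_smul_comm, ← Nat.cast_smul_eq_nsmul ℂ, smul_smul, ← add_smul]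
    congr 1
    simp
    ring

/-- The series `K h` satisfies `(K h)' = (x + d + ut) K h`: the term `-½t²T` from `K'` cancels the
term `+½t²T` from `h'`. -/
theorem add_add_pow {x d t : R} (hd : d * x = x * d + (2⁻¹ : ℂ) • t ^ 2) (hx : Commute t x)
    (hdt : Commute t d) (u : ℂ) (N : ℕ) :
    (x + d + u • t) ^ N =
      (N ! : ℂ) • conv (conv (divPow x) (divPow d)) (hermiteTerm u t) N := by
  induction N with
  | zero => simp [conv, divPow, hermiteTerm, aPoly_zero]
  | succ N ih =>
    have hK : ∀ i, Commute t (conv (divPow x) (divPow d) i) := fun i =>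
      Commute.sum_right _ _ _ fun p _ =>
        ((hx.pow_right _).smul_right _).mul_right ((hdt.pow_right _).smul_right _)
    have hc : Commute ((2⁻¹ : ℂ) • t ^ 2) x := (hx.pow_left 2).smul_left _
    rw [pow_succ', ih, mul_smul_comm, Nat.factorial_succ, Nat.cast_mul, mul_comm, mul_smul,
      Nat.cast_smul_eq_nsmul ℂ (N + 1), conv_succ]
    congr 1
    set K := conv (divPow x) (divPow d)
    set h := hermiteTerm u t
    have e1 : (∑ p ∈ Finset.HasAntidiagonal.antidiagonal N, K p.1 * ((p.2 + 1) • h (p.2 + 1))) =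
        (∑ p ∈ Finset.HasAntidiagonal.antidiagonal N, K p.1 * (u • t * h p.2)) +
          (2⁻¹ : ℂ) • t ^ 2 * conv K (shift h) N := by
      rw [conv, Finset.mul_sum, ← Finset.sum_add_distrib]
      refine Finset.sum_congr rfl fun p _ => ?_
      rw [succ_smul_hermiteTerm_succ, mul_add]
      congr 1
      rw [← mul_assoc, ← mul_assoc, (((hK p.1).pow_left 2).smul_left _).eq]
    rw [e1, conv_shift_right, ← conv_shift_left, conv, conv, Finset.mul_sum, Finset.mul_sum,
      ← Finset.sum_add_distrib, ← Finset.sum_add_distrib]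
    refine Finset.sum_congr rfl fun p _ => ?_
    rw [← mul_assoc, add_mul, add_mul_conv_divPow hd hc, ← ((hK p.1).smul_left u).symm.eq,
      add_mul, add_mul, mul_assoc (K p.1), ← mul_assoc ((2⁻¹ : ℂ) • t ^ 2)]
    abel

end Heisenberg

/-! ### Canonical commutation relations for the entries of `M` and `D`. -/

section Weyl

theorem derivOp_mul_mulOp {n : ℕ} (p q : Coord n) :
    derivOp p * mulOp q = mulOp q * derivOp p + if p = q then 1 else 0 := by
  refine LinearMap.ext fun f => ?_
  have : derivOp p (mulOp q f) = mulOp q (derivOp p f) + MvPolynomial.pderiv p (.X q) * f := by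
    simp [derivOp, mulOp, mul_comm, add_comm]
  rw [LinearMap.add_apply, Module.End.mul_apply, Module.End.mul_apply, this, MvPolynomial.pderiv_X]
  congr 1
  by_cases h : p = q
  · subst h; simp
  · simp [h]

theorem altMatrix_of_lt {n : ℕ} {R : Type*} [Ring R] (f : Coord n → R) {i j : Fin n} (h : i < j) :
    altMatrix f i j = f ⟨(i, j), h⟩ := by
  simp [altMatrix, h]

theorem altMatrix_self {n : ℕ} {R : Type*} [Ring R] (f : Coord n → R) (i : Fin n) :
    altMatrix f i i = 0 := by
  simp [altMatrix]

theorem altMatrix_swap {n : ℕ} {R : Type*} [Ring R] (f : Coord n → R) (i j : Fin n) :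
    altMatrix f i j = -altMatrix f j i := by
  rcases lt_trichotomy i j with h | rfl | h
  · simp [altMatrix, h, h.not_gt]
  · simp [altMatrix]
  · simp [altMatrix, h, h.not_gt]

/-- An identity which is antisymmetric in `i, j` need only be proved for `i < j`. -/
theorem antisymm_induction {n : ℕ} {P : Fin n → Fin n → Prop} (hlt : ∀ i j, i < j → P i j)
    (hself : ∀ i, P i i) (hswap : ∀ i j, P i j → P j i) (i j : Fin n) : P i j := by
  rcases lt_trichotomy i j with h | rfl | h
  · exact hlt i j h
  · exact hself i
  · exact hswap j i (hlt j i h)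

theorem altMatrix_mul_altMatrix {n : ℕ} {R : Type*} [Ring R] (f g : Coord n → R)
    (h : ∀ p q, f p * g q = g q * f p + if p = q then 1 else 0) (a b i j : Fin n) :
    altMatrix f a b * altMatrix g i j = altMatrix g i j * altMatrix f a b +
      ((if a = i then 1 else 0) * (if b = j then 1 else 0) -
        (if a = j then 1 else 0) * (if b = i then 1 else 0)) := by
  refine antisymm_induction (P := fun a b =>
    altMatrix f a b * altMatrix g i j = altMatrix g i j * altMatrix f a b +
      ((if a = i then 1 else 0) * (if b = j then 1 else 0) -
        (if a = j then 1 else 0) * (if b = i then 1 else 0))) ?_ ?_ ?_ a b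
  · intro a b hab
    refine antisymm_induction (P := fun i j =>
      altMatrix f a b * altMatrix g i j = altMatrix g i j * altMatrix f a b +
        ((if a = i then 1 else 0) * (if b = j then 1 else 0) -
          (if a = j then 1 else 0) * (if b = i then 1 else 0))) ?_ ?_ ?_ i j
    · intro i j hij
      rw [altMatrix_of_lt _ hab, altMatrix_of_lt _ hij, h]
      congr 1
      -- Both index pairs are increasing, so the crossed contraction is absent.
      have h1 : ¬ (a = j ∧ b = i) := by rintro ⟨rfl, rfl⟩; exact hab.asymm hij
      have h2 : ((⟨(a, b), hab⟩ : Coord n) = ⟨(i, j), hij⟩) ↔ (a = i ∧ b = j) := by simp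
      rw [if_congr h2 rfl rfl, ite_and]
      split_ifs <;> simp_all
    · intro i
      simp [altMatrix_self]
    · intro i j h
      rw [altMatrix_swap _ j i, mul_neg, h, neg_mul]
      abel
  · intro a
    simp only [altMatrix_self, zero_mul, mul_zero, zero_add]
    split_ifs <;> simp
  · intro a b h
    rw [altMatrix_swap _ b a, neg_mul, h, mul_neg]
    split_ifs <;> simp [add_comm]

end Weyl

/-! ### Expansion of `(x + d + uτ)^n` in total degree `n`. -/

section Expansion

open ExteriorAlgebra
open scoped TensorProduct

variable {V : Type*} [AddCommGroup V] [Module ℂ V] {A : Type*} [Ring A] [Algebra ℂ A] {n : ℕ}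
  (X Y : Matrix (Fin n) (Fin n) A) (v w : Fin n → V)

/-- The element `½ ∑ X_{a,b} v_a ∧ v_b`. -/
def quadM : A ⊗[ℂ] ExteriorAlgebra ℂ V := (2 : ℂ)⁻¹ • quad X v

/-- The element `-½ ∑ Y_{a,b} w_a ∧ w_b`. -/
def quadD : A ⊗[ℂ] ExteriorAlgebra ℂ V := (-(2 : ℂ)⁻¹) • quad Y w

variable (A) in
/-- The element `∑ v_a ∧ w_a`. -/
def tau : A ⊗[ℂ] ExteriorAlgebra ℂ V := 1 ⊗ₜ[ℂ] pairing v w Finset.univ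

/-- `∑_{|I| = 2k} Pf(X_I) Pf(Y_I)`. -/
def pfSum (k : ℕ) : A :=
  ∑ I : {I : Finset (Fin n) // I.card = 2 * k}, pf (subMat X I.1 I.2) * pf (subMat Y I.1 I.2)

/-- The canonical commutation relations between the entries of `Y` and those of `X`. -/
def CCR : Prop := ∀ a b i j, Y a b * X i j = X i j * Y a b +
  ((if a = i then 1 else 0) * (if b = j then 1 else 0) -
    (if a = j then 1 else 0) * (if b = i then 1 else 0))

theorem commute_tau (x : A ⊗[ℂ] ExteriorAlgebra ℂ V) : Commute (tau A v w) x :=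
  commute_one_tmul (commute_pairing v w _) x

variable {X Y} in
theorem quadD_mul_quadM (h : CCR X Y) :
    quadD Y w * quadM X v = quadM X v * quadD Y w + (2⁻¹ : ℂ) • tau A v w ^ 2 := by
  rw [quadD, quadM, smul_mul_smul_comm, smul_mul_smul_comm,
    quad_mul_quad X Y v w h, tau, ← Nat.cast_smul_eq_nsmul ℂ]
  push_cast
  module

theorem quadM_pow_mul_quadD_pow_mul_tau {a b m : ℕ} (h : a + b + m = n) (hab : a ≠ b) :
    quadM X v ^ a * quadD Y w ^ b * tau A v w ^ m = 0 := by
  rw [quadM, quadD, smul_pow, smul_pow, smul_mul_smul_comm, smul_mul_assoc, tau,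
    quad_pow_mul_quad_pow_mul_pairing _ _ _ _ h hab, smul_zero]

theorem quadM_pow_mul_quadD_pow_mul_tau_self {k m : ℕ} (h : 2 * k + m = n) :
    (n ! : ℂ) • (quadM X v ^ k * quadD Y w ^ k * tau A v w ^ m) =
      ((k ! : ℂ) ^ 2 * m !) • (pfSum X Y k ⊗ₜ[ℂ] (pairing v w Finset.univ ^ n)) :=
  quad_pow_mul_quad_pow_mul_pairing_self _ _ v w h

variable {X Y} in
theorem quadM_add_quadD_add_tau_pow (h : CCR X Y) (u : ℂ) :
    (quadM X v + quadD Y w + u • tau A v w) ^ n = ∑ k ∈ Finset.range (n / 2 + 1),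
      ((aPoly (n - 2 * k)).eval u • pfSum X Y k) ⊗ₜ[ℂ] (pairing v w Finset.univ ^ n) := by
  rw [add_add_pow (quadD_mul_quadM v w h) (commute_tau _ _ _) (commute_tau _ _ _) u n, conv]
  simp only [conv, Finset.sum_mul, Finset.smul_sum]
  rw [Finset.sum_sigma']
  symm
  -- Only the terms `x^k d^k τ^{n-2k}` survive; the outer index splits `n` as `2k + (n - 2k)`, the
  -- inner one splits `2k` as `k + k`.
  refine Finset.sum_of_injOn (fun k => ⟨(2 * k, n - 2 * k), (k, k)⟩) ?_ ?_ ?_ ?_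
  · intro k _ l _ h
    simp at h
    exact h.2
  · intro k hk
    have : k < n / 2 + 1 := by simpa using hk
    simp only [Finset.coe_sigma, Set.mem_sigma_iff, Finset.mem_coe,
      Finset.HasAntidiagonal.mem_antidiagonal]
    omega
  · rintro ⟨⟨p, m⟩, ⟨a, b⟩⟩ h1 h2
    simp only [Finset.mem_sigma, Finset.HasAntidiagonal.mem_antidiagonal] at h1
    obtain ⟨h1, h3⟩ := h1
    simp only [divPow, hermiteTerm]
    rw [smul_mul_smul_comm, smul_smul, smul_mul_smul_comm, quadM_pow_mul_quadD_pow_mul_tau X Y v w,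
      smul_zero, smul_zero]
    · omega
    · rintro rfl
      refine h2 ⟨a, ?_, ?_⟩
      · simp only [Finset.coe_range, Set.mem_Iio]; omega
      · obtain rfl : p = 2 * a := by omega
        obtain rfl : m = n - 2 * a := by omega
        rfl
  · intro k hk
    have hk : k < n / 2 + 1 := by simpa using hk
    have h := quadM_pow_mul_quadD_pow_mul_tau_self X Y v w (k := k) (m := n - 2 * k) (by omega)
    simp only [divPow, hermiteTerm]
    rw [smul_mul_smul_comm, smul_smul, smul_mul_smul_comm, smul_comm, h, smul_smul,
      TensorProduct.smul_tmul']
    congr 2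
    have h1 : (k ! : ℂ) ≠ 0 := by exact_mod_cast Nat.factorial_ne_zero k
    have h2 : ((n - 2 * k)! : ℂ) ≠ 0 := by exact_mod_cast Nat.factorial_ne_zero _
    field_simp

end Expansion

/-! ### Top exterior coefficient and the Pfaffian of the block matrix. -/

section Top

open ExteriorAlgebra
open scoped TensorProduct

theorem ιMulti_comp_cast {V : Type*} [AddCommGroup V] [Module ℂ V] {r s : ℕ} (h : r = s)
    (z : Fin s → V) : ιMulti ℂ r (z ∘ Fin.cast h) = ιMulti ℂ s z := by
  subst h; rfl

/-- The coefficient of the top exterior power of `ℂ ^ N`. -/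
def topCoeff (N : ℕ) (A : Type*) [Ring A] [Algebra ℂ A] :
    A ⊗[ℂ] ExteriorAlgebra ℂ (Fin N → ℂ) →ₗ[ℂ] A :=
  (TensorProduct.rid ℂ A).toLinearMap ∘ₗ
    (liftAlternating (Pi.single N Matrix.detRowAlternating)).lTensor A

theorem topCoeff_tmul_ιMulti (N : ℕ) {A : Type*} [Ring A] [Algebra ℂ A] (a : A) :
    topCoeff N A (a ⊗ₜ[ℂ] ιMulti ℂ N fun i => Pi.single i (1 : ℂ)) = a := by
  rw [topCoeff, LinearMap.comp_apply, LinearMap.lTensor_tmul, liftAlternating_apply_ιMulti,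
    Pi.single_eq_same]
  have : Matrix.detRowAlternating (fun i : Fin N => (Pi.single i 1 : Fin N → ℂ)) = (1 : ℂ) := by
    have h : (fun i : Fin N => (Pi.single i 1 : Fin N → ℂ)) = (1 : Matrix (Fin N) (Fin N) ℂ) := by
      ext i j; simp [Matrix.one_apply, Pi.single_apply, eq_comm]
    rw [h]
    exact Matrix.det_one
  rw [this]
  simp

/-- The first half of the standard basis of `ℂ ^ (2 n)`. -/
def basisV (n : ℕ) (i : Fin n) : Fin (2 * n) → ℂ :=
  Pi.single (Fin.cast (two_mul n).symm (Fin.castAdd n i)) 1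

/-- The second half of the standard basis of `ℂ ^ (2 n)`, in reversed order. -/
def basisW (n : ℕ) (i : Fin n) : Fin (2 * n) → ℂ :=
  Pi.single (Fin.cast (two_mul n).symm (Fin.natAdd n i.rev)) 1

/-- The reversal built into `basisW` undoes the one in `pairing_pow_univ`, leaving the standard
basis in order and no sign. -/
theorem pairing_basis_pow (n : ℕ) : pairing (basisV n) (basisW n) Finset.univ ^ n =
    n ! • ιMulti ℂ (2 * n) fun i => Pi.single i (1 : ℂ) := by
  rw [pairing_pow_univ, ιMulti_mul_ιMulti, ← ιMulti_comp_cast (two_mul n)]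
  congr 2
  funext i
  obtain ⟨j, rfl⟩ : ∃ j, Fin.cast (two_mul n).symm j = i := ⟨Fin.cast (two_mul n) i, by simp⟩
  refine Fin.addCases (fun j => ?_) (fun j => ?_) j
  · simp [basisV]
  · rw [Function.comp_apply, Fin.cast_cast, Fin.cast_eq_self, Fin.append_right]
    simp [basisW]

theorem quad_pow_self {V : Type*} [AddCommGroup V] [Module ℂ V] {A : Type*} [Ring A] [Algebra ℂ A]
    {n : ℕ} (X : Matrix (Fin (2 * n)) (Fin (2 * n)) A) (z : Fin (2 * n) → V) :
    quad X z ^ n = ((2 ^ n * n ! : ℕ) : ℂ) • (pf X ⊗ₜ[ℂ] ιMulti ℂ (2 * n) z) := by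
  have h : (Finset.univ : Finset (Fin (2 * n))).card = 2 * n := by simp
  have hid : ∀ i, Finset.univ.orderEmbOfFin h i = i := fun i => by
    have := Finset.orderEmbOfFin_unique' h (f := RelEmbedding.refl _) (fun x => Finset.mem_univ _)
    rw [← this]; rfl
  rw [quad_pow_eq_sum_pf, Fintype.sum_eq_single ⟨Finset.univ, h⟩]
  · congr 2
    · congr 1
      ext i j
      simp [subMat, hid]
    · rw [wedge]
      congr 1
      funext i
      simp [hid]
  · rintro ⟨I, hI⟩ hne
    refine absurd (Subtype.ext ?_) hne
    exact Finset.card_eq_iff_eq_univ I |>.1 (by simpa using hI)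

/-- The block matrix with blocks `X`, `u J`, `-u J` and `(Y_{n+1-b,n+1-a})_{a,b}`. -/
def blockMat {A : Type*} [Ring A] [Algebra ℂ A] {n : ℕ} (X Y : Matrix (Fin n) (Fin n) A) (u : ℂ) :
    Matrix (Fin (2 * n)) (Fin (2 * n)) A :=
  Matrix.reindex (finSumFinEquiv.trans (finCongr (two_mul n).symm))
    (finSumFinEquiv.trans (finCongr (two_mul n).symm))
    (Matrix.fromBlocks X (u • antiId n A) (-(u • antiId n A))
      (Matrix.of fun a b => Y b.rev a.rev))

/-- The two off-diagonal blocks each give `uτ`, the sign of the lower one being absorbed by `w v =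
-v w`. The transposition in the lower right block accounts for the minus sign in `quadD`. -/
theorem quad_blockMat {V : Type*} [AddCommGroup V] [Module ℂ V] {A : Type*} [Ring A] [Algebra ℂ A]
    {n : ℕ} (X Y : Matrix (Fin n) (Fin n) A) (hY : ∀ i j, Y i j = -Y j i) (u : ℂ)
    (v w : Fin n → V) (z : Fin (2 * n) → V)
    (hv : ∀ i, z (Fin.cast (two_mul n).symm (Fin.castAdd n i)) = v i)
    (hw : ∀ i, z (Fin.cast (two_mul n).symm (Fin.natAdd n i)) = w i.rev) :
    quad (blockMat X Y u) z = (2 : ℂ) • (quadM X v + quadD Y w + u • tau A v w) := by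
  let e : Fin n ⊕ Fin n ≃ Fin (2 * n) := finSumFinEquiv.trans (finCongr (two_mul n).symm)
  have hl : ∀ i, z (e (Sum.inl i)) = v i := hv
  have hr : ∀ i, z (e (Sum.inr i)) = w i.rev := hw
  have hΦ : ∀ a b, blockMat X Y u (e a) (e b) = Matrix.fromBlocks X (u • antiId n A)
      (-(u • antiId n A)) (Matrix.of fun a b => Y b.rev a.rev) a b := fun a b => by
    change Matrix.reindex e e _ _ _ = _
    simp
  have h1 : ∑ i, ∑ j, (u • antiId n A) i j ⊗ₜ[ℂ] (ι ℂ (v i) * ι ℂ (w j.rev)) =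
      u • tau A v w := by
    rw [tau, pairing, TensorProduct.tmul_sum, Finset.smul_sum]
    refine Finset.sum_congr rfl fun i _ => ?_
    rw [Finset.sum_eq_single i.rev]
    · simp [antiId, TensorProduct.smul_tmul']
    · intro j _ hj
      simp [antiId, hj]
    · simp
  have h2 : ∑ i, ∑ j, (-(u • antiId n A)) i j ⊗ₜ[ℂ] (ι ℂ (w i.rev) * ι ℂ (v j)) =
      u • tau A v w := by
    rw [← h1, Finset.sum_comm]
    refine Finset.sum_congr rfl fun i _ => Finset.sum_congr rfl fun j _ => ?_
    have e : (-(u • antiId n A)) j i = -((u • antiId n A) i j) := by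
      rw [Matrix.neg_apply]
      congr 1
      simp only [antiId, Matrix.smul_apply, Matrix.of_apply]
      refine congrArg _ (if_congr ?_ rfl rfl)
      constructor <;> (rintro rfl; simp)
    rw [e, ι_mul_ι_comm]
    rw [TensorProduct.neg_tmul, TensorProduct.tmul_neg, neg_neg]
  have h3 : ∑ i : Fin n, ∑ j : Fin n, (Y j.rev i.rev) ⊗ₜ[ℂ] (ι ℂ (w i.rev) * ι ℂ (w j.rev)) =
      (2 : ℂ) • quadD Y w := by
    rw [quadD, smul_smul, mul_neg, mul_inv_cancel₀ two_ne_zero, neg_one_smul, quad,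
      ← Equiv.sum_comp Fin.revPerm, ← Finset.sum_neg_distrib]
    refine Finset.sum_congr rfl fun i _ => ?_
    rw [← Equiv.sum_comp Fin.revPerm, ← Finset.sum_neg_distrib]
    refine Finset.sum_congr rfl fun j _ => ?_
    simp only [Fin.revPerm_apply, Fin.rev_rev]
    rw [hY, TensorProduct.neg_tmul]
  have h4 : quad X v = (2 : ℂ) • quadM X v := by
    rw [quadM, smul_smul, mul_inv_cancel₀ two_ne_zero, one_smul]
  rw [quad, ← e.sum_comp]
  simp only [← e.sum_comp (fun b => blockMat X Y u _ b ⊗ₜ[ℂ] (ι ℂ (z _) * ι ℂ (z b)))]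
  simp only [hΦ, Fintype.sum_sum_type, hl, hr, Matrix.fromBlocks_apply₁₁,
    Matrix.fromBlocks_apply₁₂, Matrix.fromBlocks_apply₂₁, Matrix.fromBlocks_apply₂₂,
    Finset.sum_add_distrib, Matrix.of_apply]
  rw [h1, h2, h3]
  rw [← quad, h4]
  module

theorem antiId_mul_self (m : ℕ) (R : Type*) [Ring R] : antiId m R * antiId m R = 1 := by
  ext i j
  rw [Matrix.mul_apply, Finset.sum_eq_single i.rev]
  · simp [antiId, Matrix.one_apply, eq_comm]
  · intro k _ hk
    simp [antiId, hk]
  · simp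

/-- Take `n`-th powers in `quad_blockMat` for the standard basis and compare top coefficients; both
sides carry the factor `2^n n!`. -/
theorem pf_blockMat {A : Type*} [Ring A] [Algebra ℂ A] {n : ℕ} (X Y : Matrix (Fin n) (Fin n) A)
    (hY : ∀ i j, Y i j = -Y j i) (h : CCR X Y) (u : ℂ) :
    pf (blockMat X Y u) = ∑ k ∈ Finset.range (n / 2 + 1),
      (aPoly (n - 2 * k)).eval u • pfSum X Y k := by
  have h1 := quad_blockMat X Y hY u (basisV n) (basisW n) (fun i => Pi.single i (1 : ℂ))
    (fun _ => rfl) (fun _ => by simp [basisW])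
  have h2 := congrArg (· ^ n) h1
  simp only [smul_pow, quad_pow_self, quadM_add_quadD_add_tau_pow _ _ h] at h2
  rw [← TensorProduct.sum_tmul, pairing_basis_pow] at h2
  have h3 := congrArg (topCoeff (2 * n) A) h2
  rw [← Nat.cast_smul_eq_nsmul ℂ, TensorProduct.tmul_smul, map_smul, map_smul, map_smul,
    topCoeff_tmul_ιMulti, topCoeff_tmul_ιMulti, smul_smul] at h3
  push_cast at h3
  exact smul_right_injective _ (by
    exact mul_ne_zero (by simp) (by exact_mod_cast Nat.factorial_ne_zero n)) h3

theorem ccr_matM_matD (n : ℕ) : CCR (matM n) (matD n) :=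
  altMatrix_mul_altMatrix _ _ derivOp_mul_mulOp

theorem antiPf_Phi (n : ℕ) (u : ℂ) :
    antiPf (Phi n u) = ∑ k ∈ Finset.range (n / 2 + 1),
      (aPoly (n - 2 * k)).eval u • Gam n k := by
  rw [antiPf, Phi, Matrix.mul_assoc, antiId_mul_self, Matrix.mul_one]
  exact pf_blockMat (matM n) (matD n) (altMatrix_swap _) (ccr_matM_matD n) u

end Top

/-! ### Operators that transform `X` and `Y` contragrediently commute with the Pfaffian sums. -/

section Intertwining

open ExteriorAlgebra
open scoped TensorProduct

variable {V : Type*} [AddCommGroup V] [Module ℂ V] {A : Type*} [Ring A] [Algebra ℂ A] {n : ℕ}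

theorem ι_sum_smul_mul_ι_sum_smul {α β : Type*} [Fintype α] [Fintype β] (c : α → ℂ) (d : β → ℂ)
    (v : α → V) (w : β → V) :
    ι ℂ (∑ a, c a • v a) * ι ℂ (∑ b, d b • w b) =
      ∑ a, ∑ b, (c a * d b) • (ι ℂ (v a) * ι ℂ (w b)) := by
  simp only [map_sum, map_smul, Finset.sum_mul_sum, smul_mul_smul_comm]

theorem quad_sum_smul (X : Matrix (Fin n) (Fin n) A) (h : Matrix (Fin n) (Fin n) ℂ)
    (v : Fin n → V) :
    quad X (fun a => ∑ i, h i a • v i) =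
      quad (Matrix.of fun i j => ∑ a, ∑ b, (h i a * h j b) • X a b) v := by
  have e1 : quad X (fun a => ∑ i, h i a • v i) = ∑ a, ∑ b, ∑ i, ∑ j,
      (h i a * h j b) • (X a b ⊗ₜ[ℂ] (ι ℂ (v i) * ι ℂ (v j))) := by
    simp only [quad, ι_sum_smul_mul_ι_sum_smul, TensorProduct.tmul_sum, TensorProduct.tmul_smul]
  have e2 : quad (Matrix.of fun i j => ∑ a, ∑ b, (h i a * h j b) • X a b) v =
      ∑ i, ∑ j, ∑ a, ∑ b, (h i a * h j b) • (X a b ⊗ₜ[ℂ] (ι ℂ (v i) * ι ℂ (v j))) := by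
    simp only [quad, Matrix.of_apply, TensorProduct.sum_tmul, TensorProduct.smul_tmul']
  rw [e1, e2]
  calc _ = ∑ p : Fin n × Fin n, ∑ q : Fin n × Fin n, (h q.1 p.1 * h q.2 p.2) •
        (X p.1 p.2 ⊗ₜ[ℂ] (ι ℂ (v q.1) * ι ℂ (v q.2))) := by
        simp only [Fintype.sum_prod_type]
    _ = _ := by
        rw [Finset.sum_comm]
        simp only [Fintype.sum_prod_type]

theorem tmul_one_mul_quad (P : A) (X : Matrix (Fin n) (Fin n) A) (v : Fin n → V) :
    (P ⊗ₜ[ℂ] 1) * quad X v = quad (Matrix.of fun i j => P * X i j) v := by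
  simp [quad, Finset.mul_sum]

theorem quad_mul_tmul_one (P : A) (X : Matrix (Fin n) (Fin n) A) (v : Fin n → V) :
    quad X v * (P ⊗ₜ[ℂ] 1) = quad (Matrix.of fun i j => X i j * P) v := by
  simp [quad, Finset.sum_mul]

theorem pairing_sum_smul (h : Matrix (Fin n) (Fin n) ℂ) (v w : Fin n → V) :
    pairing (fun a => ∑ i, h i a • v i) w Finset.univ =
      pairing v (fun i => ∑ a, h i a • w a) Finset.univ := by
  simp only [pairing, map_sum, map_smul, Finset.sum_mul, Finset.mul_sum, smul_mul_assoc,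
    mul_smul_comm]
  exact Finset.sum_comm

/-- The substitution is moved from the matrix entries to the vectors. Moving `P` across `x^k d^k
τ^{n-2k}` replaces `(v, w')` by `(v', w)`, but these have the same pairing `τ`, so both products are
the same multiple of the same Pfaffian sum tensor `τ^n`. -/
theorem semiconjBy_pfSum {P : A} {X Y : Matrix (Fin n) (Fin n) A} {h : Matrix (Fin n) (Fin n) ℂ}
    (hX : ∀ i j, P * X i j = ∑ a, ∑ b, (h i a * h j b) • (X a b * P))
    (hY : ∀ a b, Y a b * P = ∑ i, ∑ j, (h i a * h j b) • (P * Y i j))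
    (v w : Fin n → V) (k : ℕ) (hk : 2 * k ≤ n) :
    SemiconjBy (P ⊗ₜ[ℂ] 1)
      (pfSum X Y k ⊗ₜ[ℂ] (pairing v (fun i => ∑ a, h i a • w a) Finset.univ ^ n))
      (pfSum X Y k ⊗ₜ[ℂ] (pairing v (fun i => ∑ a, h i a • w a) Finset.univ ^ n)) := by
  set v' : Fin n → V := fun a => ∑ i, h i a • v i
  set w' : Fin n → V := fun i => ∑ a, h i a • w a with hw'
  have hp : pairing v' w Finset.univ = pairing v w' Finset.univ := pairing_sum_smul h v w
  have h1 : SemiconjBy (P ⊗ₜ[ℂ] 1) (quadM X v) (quadM X v') := by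
    rw [SemiconjBy, quadM, quadM, mul_smul_comm, smul_mul_assoc, tmul_one_mul_quad,
      quad_mul_tmul_one, quad_sum_smul]
    congr 2
    ext i j
    exact hX i j
  have h2 : SemiconjBy (P ⊗ₜ[ℂ] 1) (quadD Y w') (quadD Y w) := by
    rw [SemiconjBy, quadD, quadD, mul_smul_comm, smul_mul_assoc, tmul_one_mul_quad,
      quad_mul_tmul_one]
    have := quad_sum_smul (Matrix.of fun i j => P * Y i j) h.transpose w
    simp only [Matrix.transpose_apply] at this
    rw [hw', this]
    congr 2
    ext a b
    exact (hY a b).symm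
  have h3 : SemiconjBy (P ⊗ₜ[ℂ] 1) (tau A v w') (tau A v' w) := by
    rw [tau, tau, hp]
    exact (commute_tau v w' _).symm
  have h4 := ((h1.pow_right k).mul_right (h2.pow_right k)).mul_right (h3.pow_right (n - 2 * k))
  have e1 := quadM_pow_mul_quadD_pow_mul_tau_self X Y v w' (k := k) (m := n - 2 * k) (by omega)
  have e2 := quadM_pow_mul_quadD_pow_mul_tau_self X Y v' w (k := k) (m := n - 2 * k) (by omega)
  rw [hp] at e2
  have hc : (k ! : ℂ) ^ 2 * (n - 2 * k)! ≠ 0 :=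
    mul_ne_zero (pow_ne_zero _ (by exact_mod_cast Nat.factorial_ne_zero k))
      (by exact_mod_cast Nat.factorial_ne_zero _)
  refine smul_right_injective _ hc ?_
  change _ • _ = _ • _
  rw [← mul_smul_comm, ← smul_mul_assoc]
  nth_rw 1 [← e1]
  rw [← e2, mul_smul_comm, smul_mul_assoc, h4.eq]

theorem commute_pfSum {P : A} {X Y : Matrix (Fin n) (Fin n) A} {h g : Matrix (Fin n) (Fin n) ℂ}
    (hg : h * g = 1)
    (hX : ∀ i j, P * X i j = ∑ a, ∑ b, (h i a * h j b) • (X a b * P))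
    (hY : ∀ a b, Y a b * P = ∑ i, ∑ j, (h i a * h j b) • (P * Y i j))
    (k : ℕ) (hk : 2 * k ≤ n) : P * pfSum X Y k = pfSum X Y k * P := by
  -- The family `w = g · basisW` is chosen so that `h` carries it back to `basisW`, where the top
  -- coefficient can be read off.
  have h1 := (semiconjBy_pfSum hX hY (basisV n) (fun a => ∑ b, g a b • basisW n b) k hk).eq
  have h2 : (fun i => ∑ a, h i a • ∑ b, g a b • basisW n b) = basisW n := by
    funext i
    simp only [Finset.smul_sum, smul_smul]
    rw [Finset.sum_comm]
    simp only [← Finset.sum_smul, ← Matrix.mul_apply, hg, Matrix.one_apply, ite_smul, one_smul,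
      zero_smul, Finset.sum_ite_eq, Finset.mem_univ, if_true]
  rw [h2, pairing_basis_pow, Algebra.TensorProduct.tmul_mul_tmul,
    Algebra.TensorProduct.tmul_mul_tmul, one_mul, mul_one, ← Nat.cast_smul_eq_nsmul ℂ,
    TensorProduct.tmul_smul, TensorProduct.tmul_smul] at h1
  have hn : (n ! : ℂ) ≠ 0 := by exact_mod_cast Nat.factorial_ne_zero n
  have h3 := congrArg (topCoeff (2 * n) A) (smul_right_injective _ hn h1)
  rwa [topCoeff_tmul_ιMulti, topCoeff_tmul_ιMulti] at h3

end Intertwining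

/-! ### The action of `GL_n` on coordinates and derivations. -/

section Action

variable {n : ℕ}

theorem genericAlt_swap (i j : Fin n) : genericAlt n i j = -genericAlt n j i :=
  altMatrix_swap _ i j

theorem matM_apply (i j : Fin n) (f : PolyAlt n) : matM n i j f = genericAlt n i j * f := by
  refine antisymm_induction (P := fun i j => matM n i j f = genericAlt n i j * f) ?_ ?_ ?_ i j
  · intro i j h
    rw [matM, genericAlt, altMatrix_of_lt _ h, altMatrix_of_lt _ h]
    rfl
  · intro i
    rw [matM, genericAlt, altMatrix_self, altMatrix_self, zero_mul]
    rfl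
  · intro i j h
    have e : matM n j i = -matM n i j := altMatrix_swap _ j i
    rw [e, genericAlt_swap j i, neg_mul, ← h]
    rfl

theorem matD_mul (i j : Fin n) (f g : PolyAlt n) :
    matD n i j (f * g) = f * matD n i j g + g * matD n i j f := by
  refine antisymm_induction (P := fun i j =>
    matD n i j (f * g) = f * matD n i j g + g * matD n i j f) ?_ ?_ ?_ i j
  · intro i j h
    rw [matD, altMatrix_of_lt _ h]
    exact Derivation.leibniz _ f g
  · intro i
    rw [matD, altMatrix_self]
    simp
  · intro i j h
    have e : matD n j i = -matD n i j := altMatrix_swap _ j i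
    rw [e, LinearMap.neg_apply, LinearMap.neg_apply, LinearMap.neg_apply, h]
    ring

theorem matD_one (i j : Fin n) : matD n i j 1 = 0 := by
  have := matD_mul i j 1 1
  simpa using this

theorem matD_C (i j : Fin n) (c : ℂ) : matD n i j (MvPolynomial.C c) = 0 := by
  rw [← mul_one (MvPolynomial.C c), ← MvPolynomial.smul_eq_C_mul, map_smul, matD_one, smul_zero]

theorem matD_genericAlt (a b i j : Fin n) : matD n a b (genericAlt n i j) =
    (if a = i then 1 else 0) * (if b = j then 1 else 0) -
      (if a = j then 1 else 0) * (if b = i then 1 else 0) := by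
  have h := LinearMap.congr_fun (ccr_matM_matD n a b i j) 1
  rw [LinearMap.add_apply, Module.End.mul_apply, Module.End.mul_apply, matD_one, map_zero, zero_add,
    matM_apply, mul_one] at h
  rw [h]
  split_ifs <;> simp

theorem sum_smul_matD_genericAlt (c : Fin n → Fin n → ℂ) (k l : Fin n) :
    ∑ i, ∑ j, c i j • matD n k l (genericAlt n i j) = (c k l - c l k) • (1 : PolyAlt n) := by
  simp only [matD_genericAlt, smul_sub, Finset.sum_sub_distrib, sub_smul]
  congr 1
  · rw [Finset.sum_eq_single k (fun i _ hi => by simp [hi.symm]) (by simp),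
      Finset.sum_eq_single l (fun j _ hj => by simp [hj.symm]) (by simp)]
    simp
  · rw [Finset.sum_eq_single l (fun i _ hi => by simp [hi.symm]) (by simp),
      Finset.sum_eq_single k (fun j _ hj => by simp [hj.symm]) (by simp)]
    simp

variable (g : Matrix.GeneralLinearGroup (Fin n) ℂ)

/-- The substitution homomorphism underlying `glRep`. -/
def glHom : PolyAlt n →ₐ[ℂ] PolyAlt n :=
  let h : Matrix (Fin n) (Fin n) (PolyAlt n) :=
    ((g⁻¹ : Matrix.GeneralLinearGroup (Fin n) ℂ) : Matrix (Fin n) (Fin n) ℂ).map MvPolynomial.C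
  MvPolynomial.aeval fun p : Coord n => (h * genericAlt n * h.transpose) p.1.1 p.1.2

theorem glRep_apply (f : PolyAlt n) : glRep g f = glHom g f := rfl

theorem glHom_genericAlt (i j : Fin n) : glHom g (genericAlt n i j) =
    ∑ a, ∑ b, ((g⁻¹).1 i a * (g⁻¹).1 j b) • genericAlt n a b := by
  refine antisymm_induction (P := fun i j => glHom g (genericAlt n i j) =
    ∑ a, ∑ b, ((g⁻¹).1 i a * (g⁻¹).1 j b) • genericAlt n a b) ?_ ?_ ?_ i j
  · intro i j h
    rw [genericAlt, altMatrix_of_lt _ h, glHom, MvPolynomial.aeval_X]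
    simp only [Matrix.mul_apply, Finset.sum_mul, Matrix.map_apply, Matrix.transpose_apply]
    rw [Finset.sum_comm]
    refine Finset.sum_congr rfl fun a _ => Finset.sum_congr rfl fun b _ => ?_
    rw [MvPolynomial.smul_eq_C_mul, map_mul]
    simp only [genericAlt]
    ring
  · intro i
    rw [genericAlt, altMatrix_self, map_zero]
    have h : ∑ a, ∑ b, ((g⁻¹).1 i a * (g⁻¹).1 i b) • genericAlt n a b =
        -∑ a, ∑ b, ((g⁻¹).1 i a * (g⁻¹).1 i b) • genericAlt n a b := by
      conv_lhs => rw [Finset.sum_comm]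
      simp only [← Finset.sum_neg_distrib]
      refine Finset.sum_congr rfl fun a _ => Finset.sum_congr rfl fun b _ => ?_
      rw [genericAlt_swap, smul_neg, mul_comm]
    -- The sum equals its own negative.
    exact (self_eq_neg.1 h).symm
  · intro i j h
    rw [genericAlt_swap j i, map_neg, h, Finset.sum_comm]
    simp only [← Finset.sum_neg_distrib]
    refine Finset.sum_congr rfl fun a _ => Finset.sum_congr rfl fun b _ => ?_
    rw [genericAlt_swap, smul_neg, neg_neg, mul_comm]

theorem glRep_mul_matM (i j : Fin n) : glRep g * matM n i j =
    ∑ a, ∑ b, ((g⁻¹).1 i a * (g⁻¹).1 j b) • (matM n a b * glRep g) := by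
  refine LinearMap.ext fun f => ?_
  simp only [LinearMap.sum_apply, LinearMap.smul_apply, Module.End.mul_apply, matM_apply,
    glRep_apply, map_mul, glHom_genericAlt, Finset.sum_mul, smul_mul_assoc]

/-- The chain rule: both sides obey the same Leibniz rule along `glHom g`, so it suffices to compare
them on coordinates. -/
theorem matD_mul_glRep (a b : Fin n) : matD n a b * glRep g =
    ∑ i, ∑ j, ((g⁻¹).1 i a * (g⁻¹).1 j b) • (glRep g * matD n i j) := by
  refine LinearMap.ext fun f => ?_
  simp only [LinearMap.sum_apply, LinearMap.smul_apply, Module.End.mul_apply, glRep_apply]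
  induction f using MvPolynomial.induction_on with
  | C c =>
    have : glHom g (MvPolynomial.C c) = MvPolynomial.C c := (glHom g).commutes c
    simp [this, matD_C]
  | add p q hp hq => simp only [map_add, hp, hq, smul_add, Finset.sum_add_distrib]
  | mul_X p q hp =>
    have hX : matD n a b (glHom g (MvPolynomial.X q)) =
        ∑ i, ∑ j, ((g⁻¹).1 i a * (g⁻¹).1 j b) • glHom g (matD n i j (MvPolynomial.X q)) := by
      have e : (MvPolynomial.X q : PolyAlt n) = genericAlt n q.1.1 q.1.2 :=
        (altMatrix_of_lt _ q.2).symm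
      -- The value of `∂_{ij}` on `x_{kl}` is a constant, hence fixed by `glHom g`, and is symmetric
      -- under exchanging the two index pairs. Both sides then become the same 2×2 minor of `g⁻¹`.
      have h1 : ∀ i j k l : Fin n, glHom g (matD n i j (genericAlt n k l)) =
          matD n k l (genericAlt n i j) := fun i j k l => by
        rw [matD_genericAlt, matD_genericAlt]
        simp only [eq_comm (a := k), eq_comm (a := l)]
        split_ifs <;> simp
      rw [e, glHom_genericAlt]
      simp only [map_sum, map_smul, h1]
      rw [sum_smul_matD_genericAlt fun c d => (g⁻¹).1 q.1.1 c * (g⁻¹).1 q.1.2 d,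
        sum_smul_matD_genericAlt fun i j => (g⁻¹).1 i a * (g⁻¹).1 j b,
        mul_comm ((g⁻¹).1 q.1.2 a)]
    rw [map_mul, matD_mul, hX, hp]
    simp only [matD_mul, map_add, map_mul, smul_add, Finset.sum_add_distrib, Finset.mul_sum,
      mul_smul_comm]

theorem altMatrix_mem {R : Type*} [Ring R] [Algebra ℂ R] (S : Subalgebra ℂ R) (f : Coord n → R)
    (hf : ∀ p, f p ∈ S) (i j : Fin n) : altMatrix f i j ∈ S := by
  rw [altMatrix, Matrix.of_apply]
  split_ifs
  · exact hf _
  · exact S.neg_mem (hf _)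
  · exact S.zero_mem

theorem pf_mem {R : Type*} [Ring R] [Algebra ℂ R] (S : Subalgebra ℂ R) {m : ℕ}
    (X : Matrix (Fin (2 * m)) (Fin (2 * m)) R) (hX : ∀ i j, X i j ∈ S) : pf X ∈ S := by
  refine S.smul_mem (S.sum_mem fun σ _ => S.zsmul_mem (S.list_prod_mem fun x hx => ?_) _) _
  obtain ⟨i, rfl⟩ := (List.mem_ofFn' _ _).1 hx
  exact hX _ _

theorem Gam_mem_invDiffOps (n k : ℕ) (hk : k ≤ n / 2) : Gam n k ∈ invDiffOps n := by
  refine ⟨Subalgebra.sum_mem _ fun I _ => Subalgebra.mul_mem _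
    (pf_mem (diffOps n) _ fun i j => altMatrix_mem (diffOps n) mulOp (fun p => ?_) _ _)
    (pf_mem (diffOps n) _ fun i j => altMatrix_mem (diffOps n) derivOp (fun p => ?_) _ _), ?_⟩
  · exact Algebra.subset_adjoin (Set.mem_union_left _ ⟨p, rfl⟩)
  · exact Algebra.subset_adjoin (Set.mem_union_right _ ⟨p, rfl⟩)
  · rintro _ ⟨g, rfl⟩
    have hg : (g⁻¹).1 * g.1 = 1 := by
      rw [← Units.val_mul, inv_mul_cancel]; rfl
    exact commute_pfSum hg (glRep_mul_matM g) (matD_mul_glRep g) k (by omega)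

end Action

end SkewCapelli

end

theorem mainTheorem1 (n : ℕ) :
    (∀ u : ℂ, SkewCapelli.antiPf (SkewCapelli.Phi n u) =
      ∑ k ∈ Finset.range (n / 2 + 1),
        (SkewCapelli.aPoly (n - 2 * k)).eval u • SkewCapelli.Gam n k) ∧
    (∀ k ≤ n / 2, SkewCapelli.Gam n k ∈ SkewCapelli.invDiffOps n) ∧
    (∀ m : ℕ, (SkewCapelli.aPoly m).Monic ∧ (SkewCapelli.aPoly m).natDegree = m ∧
      ∀ u : ℂ, (SkewCapelli.aPoly m).eval u =
        (-Complex.I / 2) ^ m * SkewCapelli.hermiteH m (Complex.I * u)) :=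
  ⟨SkewCapelli.antiPf_Phi n, SkewCapelli.Gam_mem_invDiffOps n, fun m =>
    ⟨(SkewCapelli.aPoly_monic_natDegree m).1, (SkewCapelli.aPoly_monic_natDegree m).2,
      SkewCapelli.aPoly_eval_eq_hermiteH m⟩⟩
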